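/- Let $M$ be a $W^*$-algebra, let $E$ be a $W^*$-correspondence over $M$ (a self-dual right Hilbert $M$-module with a unital, ultraweakly continuous $*$-homomorphism $\varphi:M\to\mathcal L(E)$ as left action), and let $\sigma:M\to B(H)$ be a unital normal representation on a separable Hilbert space $H$. Let $E\otimes_\sigma H$ be the Hilbert space with $\langle \xi\otimes h,\zeta\otimes k\rangle=\langle h,\sigma(\langle\xi,\zeta\rangle)k\rangle$, and similarly $E^{\otimes n}\otimes_\sigma H$ (with $E^{\otimes 0}\otimes_\sigma H=H$); let $\mathcal F(E)\otimes_\sigma H=\bigoplus_{n\ge 0}E^{\otimes n}\otimes_\sigma H$ be the Hilbert space built from the Fock space $\mathcal F(E)$. For normal representations $\rho_1,\rho_2$ of $M$, let $\mathcal I(\rho_1,\rho_2)$ be the space of bounded operators $X$ with $X\rho_1(a)=\rho_2(a)X$ for all $a\in M$. Let $\eta\in E^\sigma$, i.e. $\eta:H\to E\otimes_\sigma H$ is bounded and $\eta\,\sigma(a)=(\varphi(a)\otimes I_H)\eta$ for $a\in M$. Let $\widehat{\eta^*}(\xi)h=\eta^*(\xi\otimes h)$ for $\xi\in E$, $h\in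 H$ (so that $(\widehat{\eta^*},\sigma)$ is a completely bounded covariant representation of $(E,M)$), let $\Phi_\eta(a)=\eta^*(I_E\otimes a)\eta$ for $a\in\sigma(M)'$, and let $\eta_0=I_H$, $\eta_{n+1}=(I_E\otimes\eta_n)\eta: H\to E^{\otimes (n+1)}\otimes_\sigma H$. Let $\pi:M\to B(K_0)$ be an infinite ampliation of a faithful normal representation of $M$, and let $(S_0,\sigma_0)$ be the covariant representation induced by $\pi$ on $\mathcal F(E)\otimes_\pi K_0$: $S_0(\xi)=T_\xi\otimes I_{K_0}$, where $T_\xi$ is the creation operator $\zeta\mapsto\xi\otimes\zeta$, and $\sigma_0(a)=\varphi_\infty(a)\otimes I_{K_0}$, where $\varphi_\infty$ is the diagonal left action of $M$ on $\mathcal F(E)$. Let $\mathcal I((S_0,\sigma_0),(\widehat{\eta^*},\sigma))$ be the set of bounded operators $C:\mathcal F(E)\otimes_\pi K_0\to H$ with $C\sigma_0(a)=\sigma(a)C$ for all $a\in M$ and $CS_0(\xi)=\widehat{\eta^*}(\xi)C$ for all $\xi\in E$. Let $Q\in\sigma(M)'$. Call $Q$ a pure superharmonic operator for $\Phi_\eta$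 if $Q\ge0$, $\Phi_\eta(Q)\le Q$, and $\Phi_\eta^n(Q)\to0$ strongly as $n\to\infty$. **Theorem.** $Q$ is a pure superharmonic operator for $\Phi_\eta$ if and only if $Q=CC^*$ for some $C\in\mathcal I((S_0,\sigma_0),(\widehat{\eta^*},\sigma))$. In this event, put $r=(Q-\Phi_\eta(Q))^{1/2}\in\sigma(M)'$. Then $Bx=\big((I_{E^{\otimes n}}\otimes r)\eta_n x\big)_{n\ge0}$ defines a bounded linear operator $B$ on all of $H$ with values in $\mathcal F(E)\otimes_\sigma H$. For every partial isometry $v\in\mathcal I(\sigma,\pi)$ whose initial projection dominates the range projection of $r$, the operator $C$ with $C^*=(I_{\mathcal F(E)}\otimes v)B$ belongs to $\mathcal I((S_0,\sigma_0),(\widehat{\eta^*},\sigma))$ and satisfies $CC^*=Q$. Conversely, for every $C\in\mathcal I((S_0,\sigma_0),(\widehat{\eta^*},\sigma))$ with $CC^*=Q$ there is such a $v$ with $C^*=(I_{\mathcal F(E)}\otimes v)B$. -/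

import Mathlib

open scoped TensorProduct InnerProductSpace ComplexOrder
open Filter Topology MulOpposite

namespace WCorr

noncomputable section

set_option linter.unusedSectionVars false

universe u v w

/-! ### Hilbert modules, representations and correspondences -/

/-- A (right) inner product module over the C⋆-algebra `M`, normed by `‖ξ‖ ^ 2 = ‖⟨ξ, ξ⟩‖`; the
inner product is linear in its second variable. It is a Hilbert module when `E` is complete.
(In `CStarModule` the inner product satisfies `⟨ξ, a • ζ⟩ = a * ⟨ξ, ζ⟩`, which describes left
modules; here `⟨ξ, ζ a⟩ = ⟨ξ, ζ⟩ a`.) -/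
class HilbertModule (M : Type w) (E : Type u) [CStarAlgebra M] [PartialOrder M]
    [NormedAddCommGroup E] [NormedSpace ℂ E] [Module Mᵐᵒᵖ E] where
  /-- the `M`-valued inner product -/
  ip : E → E → M
  ip_add_right : ∀ ξ ζ ζ' : E, ip ξ (ζ + ζ') = ip ξ ζ + ip ξ ζ'
  ip_smul_right : ∀ (c : ℂ) (ξ ζ : E), ip ξ (c • ζ) = c • ip ξ ζ
  ip_op_smul_right : ∀ (a : M) (ξ ζ : E), ip ξ (op a • ζ) = ip ξ ζ * a
  star_ip : ∀ ξ ζ : E, star (ip ξ ζ) = ip ζ ξ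
  ip_self_nonneg : ∀ ξ : E, 0 ≤ ip ξ ξ
  norm_sq : ∀ ξ : E, ‖ξ‖ ^ 2 = ‖ip ξ ξ‖

/-- A (unital) `*`-representation of `M` on a Hilbert space. -/
structure HilbertRep (M : Type w) [CStarAlgebra M] where
  /-- the Hilbert space -/
  Space : Type u
  [normed : NormedAddCommGroup Space]
  [innerProduct : InnerProductSpace ℂ Space]
  [complete : CompleteSpace Space]
  /-- the `*`-homomorphism into the bounded operators -/
  hom : M →⋆ₐ[ℂ] (Space →L[ℂ] Space)

attribute [instance] HilbertRep.normed HilbertRep.innerProduct HilbertRep.complete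

instance (M : Type w) [CStarAlgebra M] : CoeSort (HilbertRep.{u} M) (Type u) :=
  ⟨HilbertRep.Space⟩

section WStar

variable {M : Type w} [CStarAlgebra M] {X : Type v} [NormedAddCommGroup X] [NormedSpace ℂ X]

/-- A functional on `M` is ultraweakly (weak-`*`) continuous when it comes from the predual `X`;
the isometry `p` presents `M` as the dual Banach space of `X`. -/
def IsNormalFunctional (p : M ≃ₗᵢ[ℂ] StrongDual ℂ X) (f : M → ℂ) : Prop :=
  ∃ x : X, ∀ a : M, f a = p a x

/-- A representation is normal when it is continuous for the weak-`*` topology of `M` and the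
ultraweak topology of `B(H)`. The latter is generated by the functionals
`T ↦ ∑ ⟨h n, T (k n)⟩` with `h`, `k` square summable. -/
def HilbertRep.IsNormal (p : M ≃ₗᵢ[ℂ] StrongDual ℂ X) (σ : HilbertRep.{u} M) : Prop :=
  ∀ h k : lp (fun _ : ℕ => (σ : Type u)) 2,
    IsNormalFunctional p fun a => ∑' n, ⟪h n, σ.hom a (k n)⟫_ℂ

/-- `π` is (unitarily equivalent to) the infinite ampliation of a faithful normal
representation. -/
def HilbertRep.IsInfiniteAmpliation (p : M ≃ₗᵢ[ℂ] StrongDual ℂ X) (π : HilbertRep.{u} M) : Prop :=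
  ∃ ρ : HilbertRep.{u} M, ρ.IsNormal p ∧ Function.Injective ρ.hom ∧
    ∃ W : π ≃ₗᵢ[ℂ] lp (fun _ : ℕ => (ρ : Type u)) 2,
      ∀ (a : M) (x : π) (n : ℕ), W (π.hom a x) n = ρ.hom a (W x n)

end WStar

section Correspondence

variable (M : Type w) [CStarAlgebra M] [PartialOrder M]
  (E : Type u) [NormedAddCommGroup E] [NormedSpace ℂ E] [Module Mᵐᵒᵖ E] [HilbertModule M E]

/-- A unital `*`-homomorphism `φ` of `M` into the adjointable operators of the module `E`. -/
structure LeftAction where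
  /-- the homomorphism -/
  toHom : M →ₐ[ℂ] (E →L[ℂ] E)
  map_op_smul : ∀ (a b : M) (ξ : E), toHom a (op b • ξ) = op b • toHom a ξ
  ip_left : ∀ (a : M) (ξ ζ : E),
    HilbertModule.ip (M := M) (toHom a ξ) ζ = HilbertModule.ip ξ (toHom (star a) ζ)

variable {M E}

/-- The module `E` with left action `φ` is a W⋆-correspondence over `M`: `E` is complete, every
bounded module map `E → M` is given by a vector, and `φ` is ultraweakly continuous. On bounded
sets the ultraweak topology of the adjointable operators is generated by the functionals
`T ↦ ω ⟨ξ, T ζ⟩` with `ω` in the predual. -/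
structure IsWStarCorrespondence {X : Type v} [NormedAddCommGroup X] [NormedSpace ℂ X]
    (p : M ≃ₗᵢ[ℂ] StrongDual ℂ X) (φ : LeftAction M E) : Prop where
  complete : CompleteSpace E
  selfDual : ∀ f : E →L[ℂ] M, (∀ (a : M) (ξ : E), f (op a • ξ) = f ξ * a) →
    ∃ ζ : E, ∀ ξ : E, f ξ = HilbertModule.ip ζ ξ
  normal : ∀ (ξ ζ : E) (x : X),
    IsNormalFunctional p fun a => p (HilbertModule.ip ξ (φ.toHom a ζ)) x

end Correspondence

/-! ### Intertwiners -/

section Intertwiners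

variable {M : Type w} [CStarAlgebra M]

/-- `𝓘(σ, τ)`: the bounded operators `X` with `X σ(a) = τ(a) X` for all `a`. -/
structure Intertwiner (σ τ : HilbertRep.{u} M) where
  /-- the operator -/
  toCLM : σ →L[ℂ] τ
  comm : ∀ (a : M) (x : σ), toCLM (σ.hom a x) = τ.hom a (toCLM x)

/-- The commutant `σ(M)'`. -/
abbrev Commutant (σ : HilbertRep.{u} M) := Intertwiner σ σ

variable {σ τ ρ : HilbertRep.{u} M}

/-- Composition of intertwiners. -/
def Intertwiner.comp (Y : Intertwiner τ ρ) (X : Intertwiner σ τ) : Intertwiner σ ρ where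
  toCLM := Y.toCLM ∘L X.toCLM
  comm a x := by simp [X.comm, Y.comm]

/-- The adjoint of an intertwiner. -/
def Intertwiner.adj (X : Intertwiner σ τ) : Intertwiner τ σ where
  toCLM := ContinuousLinearMap.adjoint X.toCLM
  comm a x := by
    refine ext_inner_right ℂ fun y => ?_
    have h1 : ContinuousLinearMap.adjoint (σ.hom a) = σ.hom (star a) := by
      rw [map_star]; rfl
    have h2 : ContinuousLinearMap.adjoint (τ.hom (star a)) = τ.hom a := by
      have : τ.hom a = star (τ.hom (star a)) := by rw [map_star, star_star]
      rw [this]; rfl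
    rw [ContinuousLinearMap.adjoint_inner_left, ← h2, ContinuousLinearMap.adjoint_inner_left,
      ← X.comm, ← h1, ← ContinuousLinearMap.adjoint_inner_left X.toCLM,
      ContinuousLinearMap.adjoint_inner_right]

/-- `v` is a partial isometry: it is isometric on its initial space `(ker v)ᗮ`. -/
def IsPartialIsometry (v : σ →L[ℂ] τ) : Prop :=
  ∀ x ∈ (LinearMap.ker (v : σ →ₗ[ℂ] τ))ᗮ, ‖v x‖ = ‖x‖

end Intertwiners

/-! ### The Hilbert space `E ⊗_σ H` -/

section Tensor

variable {M : Type w} [CStarAlgebra M] [PartialOrder M]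
  {E : Type u} [NormedAddCommGroup E] [NormedSpace ℂ E] [Module Mᵐᵒᵖ E] [HilbertModule M E]

open HilbertModule

lemma ip_add_left (ξ ξ' ζ : E) : (ip (ξ + ξ') ζ : M) = ip ξ ζ + ip ξ' ζ := by
  rw [← star_ip, ip_add_right, star_add, star_ip, star_ip]

lemma ip_smul_left (c : ℂ) (ξ ζ : E) : (ip (c • ξ) ζ : M) = star c • ip ξ ζ := by
  rw [← star_ip, ip_smul_right, star_smul, star_ip]

lemma ip_op_smul_left (a : M) (ξ ζ : E) : (ip (op a • ξ) ζ : M) = star a * ip ξ ζ := by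
  rw [← star_ip, ip_op_smul_right, star_mul, star_ip]

lemma ip_zero_right (ξ : E) : (ip ξ 0 : M) = 0 := by
  have := ip_smul_right (M := M) 0 ξ 0
  simpa using this

lemma ip_zero_left (ξ : E) : (ip 0 ξ : M) = 0 := by
  rw [← star_ip, ip_zero_right, star_zero]

lemma ip_sum_right {ι : Type*} (s : Finset ι) (ξ : E) (ζ : ι → E) :
    (ip ξ (∑ i ∈ s, ζ i) : M) = ∑ i ∈ s, ip ξ (ζ i) := by
  classical
  induction s using Finset.induction_on with
  | empty => simp [ip_zero_right]
  | insert i s hi ih => rw [Finset.sum_insert hi, Finset.sum_insert hi, ip_add_right, ih]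

lemma ip_sum_left {ι : Type*} (s : Finset ι) (ξ : ι → E) (ζ : E) :
    (ip (∑ i ∈ s, ξ i) ζ : M) = ∑ i ∈ s, ip (ξ i) ζ := by
  rw [← star_ip, ip_sum_right, star_sum]
  exact Finset.sum_congr rfl fun i _ => star_ip _ _

/-- A consequence of the decomposition `a = a⁺ - a⁻`. -/
lemma exists_neg_part {A : Type*} [CStarAlgebra A] [PartialOrder A] [StarOrderedRing A] (a : A)
    (ha : star a = a) : ∃ b d : A, star b = b ∧ a * b = -(b * b) ∧
      b * (b * b) = star d * d ∧ (d = 0 → ∃ e : A, a = star e * e) := by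
  have hb0 : 0 ≤ a⁻ := CFC.negPart_nonneg a
  have hbs : star a⁻ = a⁻ := hb0.isSelfAdjoint.star_eq
  have h3 : 0 ≤ a⁻ * (a⁻ * a⁻) := by
    have := star_left_conjugate_nonneg hb0 a⁻
    rwa [hbs, mul_assoc] at this
  obtain ⟨d, hd⟩ := CStarAlgebra.nonneg_iff_eq_star_mul_self.mp h3
  have h1 := CFC.posPart_sub_negPart a ha
  refine ⟨a⁻, d, hbs, ?_, hd, fun h => ?_⟩
  · calc a * a⁻ = (a⁺ - a⁻) * a⁻ := by rw [h1]
      _ = -(a⁻ * a⁻) := by rw [sub_mul, CFC.posPart_mul_negPart, zero_sub]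
  · rw [h, star_zero, zero_mul] at hd
    have h2 : star (a⁻ * a⁻) * (a⁻ * a⁻) = 0 := by
      rw [star_mul, hbs, mul_assoc, hd, mul_zero]
    have h4 : star a⁻ * a⁻ = 0 := by
      rw [hbs]; exact (CStarRing.star_mul_self_eq_zero_iff _).mp h2
    have h5 : a⁻ = 0 := (CStarRing.star_mul_self_eq_zero_iff _).mp h4
    refine CStarAlgebra.nonneg_iff_eq_star_mul_self.mp ?_
    rw [← h1, h5, sub_zero]
    exact CFC.posPart_nonneg a

/-- The matrix `⟨ξ i, ξ j⟩` is of the form `D⋆ D`. -/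
lemma exists_gram_factor [StarOrderedRing M] {ι : Type*} [Fintype ι] [DecidableEq ι] (ξ : ι → E) :
    ∃ D : ι → ι → M, ∀ i j, (ip (ξ i) (ξ j) : M) = ∑ k, star (D k i) * D k j := by
  let A : CStarMatrix ι ι M := CStarMatrix.ofMatrix (Matrix.of fun i j => (ip (ξ i) (ξ j) : M))
  have hAe : ∀ i j, A i j = ip (ξ i) (ξ j) := fun i j => rfl
  have hA : star A = A := by
    ext i j
    simp [CStarMatrix.star_apply, hAe, star_ip]
  obtain ⟨B, D, hBs, hAB, hD, hA0⟩ := exists_neg_part A hA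
  have hBe : ∀ i j, star (B i j) = B j i := fun i j => by
    have := congrFun (congrFun hBs j) i
    rwa [CStarMatrix.star_apply] at this
  have hdiag : ∀ k, ∑ i, star (D i k) * D i k = 0 := by
    intro k
    have hn : ∑ i, star (D i k) * D i k =
        -(ip (∑ i, MulOpposite.op (B i k) • ξ i) (∑ i, MulOpposite.op (B i k) • ξ i) : M) := by
      have e1 : (star D * D) k k = ∑ i, star (D i k) * D i k := by
        rw [CStarMatrix.mul_apply]
        exact Finset.sum_congr rfl fun i _ => by rw [CStarMatrix.star_apply]
      have e2 : (B * (A * B)) k k =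
          (ip (∑ i, MulOpposite.op (B i k) • ξ i) (∑ i, MulOpposite.op (B i k) • ξ i) : M) := by
        rw [CStarMatrix.mul_apply, ip_sum_left]
        refine Finset.sum_congr rfl fun i _ => ?_
        rw [CStarMatrix.mul_apply, ip_op_smul_left, ip_sum_right, hBe]
        congr 1
        refine Finset.sum_congr rfl fun j _ => ?_
        rw [ip_op_smul_right, hAe]
      have e3 : star D * D = -(B * (A * B)) := by
        rw [hAB, mul_neg, neg_neg]
        exact hD.symm
      rw [← e1, ← e2, e3]
      rfl
    refine le_antisymm ?_ (Finset.sum_nonneg fun i _ => star_mul_self_nonneg _)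
    rw [hn]
    exact neg_nonpos.mpr (ip_self_nonneg _)
  have hD0 : D = 0 := by
    ext i k
    have := (Finset.sum_eq_zero_iff_of_nonneg fun i _ => star_mul_self_nonneg (D i k)).mp (hdiag k)
      i (Finset.mem_univ i)
    exact (CStarRing.star_mul_self_eq_zero_iff _).mp this
  obtain ⟨F, hF⟩ := hA0 hD0
  refine ⟨fun i j => F i j, fun i j => ?_⟩
  rw [← hAe, hF, CStarMatrix.mul_apply]
  exact Finset.sum_congr rfl fun k _ => by rw [CStarMatrix.star_apply]

variable (E)

/-- The algebraic tensor product `E ⊙ H`. -/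
def AlgTensor (σ : HilbertRep.{u} M) : Type u := E ⊗[ℂ] (σ : Type u)

instance (σ : HilbertRep.{u} M) : AddCommGroup (AlgTensor E σ) :=
  inferInstanceAs (AddCommGroup (E ⊗[ℂ] (σ : Type u)))

instance (σ : HilbertRep.{u} M) : Module ℂ (AlgTensor E σ) :=
  inferInstanceAs (Module ℂ (E ⊗[ℂ] (σ : Type u)))

variable {E}

/-- The form on `E ⊗ H` with `⟨ξ ⊗ h, ζ ⊗ k⟩ = ⟨h, σ(⟨ξ, ζ⟩) k⟩`. -/
def tensorForm (σ : HilbertRep.{u} M) :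
    E ⊗[ℂ] (σ : Type u) →ₗ⋆[ℂ] E ⊗[ℂ] (σ : Type u) →ₗ[ℂ] ℂ :=
  TensorProduct.lift <|
    LinearMap.mk₂'ₛₗ (starRingEnd ℂ) (starRingEnd ℂ)
      (fun (ξ : E) (h : σ) => TensorProduct.lift <|
        LinearMap.mk₂ ℂ (fun (ζ : E) (k : σ) => ⟪h, σ.hom (ip ξ ζ) k⟫_ℂ)
          (fun ζ ζ' k => by simp [ip_add_right])
          (fun c ζ k => by simp [ip_smul_right])
          (fun ζ k k' => by simp)
          (fun c ζ k => by simp))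
      (fun ξ ξ' h => TensorProduct.ext' fun ζ k => by simp [ip_add_left])
      (fun c ξ h => TensorProduct.ext' fun ζ k => by simp [ip_smul_left])
      (fun ξ h h' => TensorProduct.ext' fun ζ k => by simp)
      (fun c ξ h => TensorProduct.ext' fun ζ k => by simp [mul_comm])

/-- The same form, on the synonym `AlgTensor E σ`. -/
def preForm (σ : HilbertRep.{u} M) : AlgTensor E σ →ₗ⋆[ℂ] AlgTensor E σ →ₗ[ℂ] ℂ :=
  tensorForm σ

/-- The elementary tensor `ξ ⊗ h` in `E ⊙ H`. -/
def AlgTensor.tmul (σ : HilbertRep.{u} M) (ξ : E) (h : σ) : AlgTensor E σ := ξ ⊗ₜ[ℂ] h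

lemma preForm_tmul (σ : HilbertRep.{u} M) (ξ ζ : E) (h k : σ) :
    preForm σ (AlgTensor.tmul σ ξ h) (AlgTensor.tmul σ ζ k) = ⟪h, σ.hom (ip ξ ζ) k⟫_ℂ := rfl

lemma AlgTensor.induction_on {σ : HilbertRep.{u} M} {P : AlgTensor E σ → Prop} (x : AlgTensor E σ)
    (h0 : P 0) (h1 : ∀ ξ h, P (AlgTensor.tmul σ ξ h)) (h2 : ∀ x y, P x → P y → P (x + y)) : P x :=
  TensorProduct.induction_on x h0 h1 h2

lemma AlgTensor.exists_sum (σ : HilbertRep.{u} M) (u : AlgTensor E σ) :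
    ∃ (ι : Type u) (_ : Fintype ι) (ξ : ι → E) (h : ι → σ), u = ∑ i, AlgTensor.tmul σ (ξ i) (h i) := by
  obtain ⟨S, hS⟩ := TensorProduct.exists_finset (R := ℂ) (M := E) (N := (σ : Type u)) u
  refine ⟨S, inferInstance, fun i => i.1.1, fun i => i.1.2, ?_⟩
  rw [hS]
  exact (Finset.sum_coe_sort S fun i => (i.1 ⊗ₜ[ℂ] i.2 : E ⊗[ℂ] (σ : Type u))).symm

section Hilbert

variable [StarOrderedRing M]

lemma preForm_sum_self (σ : HilbertRep.{u} M) {ι : Type*} [Fintype ι] (ξ : ι → E) (h : ι → σ)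
    (D : ι → ι → M) (hD : ∀ i j, (ip (ξ i) (ξ j) : M) = ∑ k, star (D k i) * D k j) :
    preForm σ (∑ i, AlgTensor.tmul σ (ξ i) (h i)) (∑ i, AlgTensor.tmul σ (ξ i) (h i)) =
      ((∑ k, ‖∑ j, σ.hom (D k j) (h j)‖ ^ 2 : ℝ) : ℂ) := by
  have h1 : ∀ (a b : M) (x y : σ), ⟪x, σ.hom (star a * b) y⟫_ℂ = ⟪σ.hom a x, σ.hom b y⟫_ℂ := by
    intro a b x y
    rw [map_mul, map_star]
    exact ContinuousLinearMap.adjoint_inner_right (σ.hom a) x (σ.hom b y)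
  simp only [map_sum, LinearMap.sum_apply, preForm_tmul, hD, sum_apply,
    inner_sum, h1, Complex.ofReal_sum]
  have h2 : ∀ k, ((‖∑ j, σ.hom (D k j) (h j)‖ ^ 2 : ℝ) : ℂ) =
      ∑ i, ∑ j, ⟪σ.hom (D k i) (h i), σ.hom (D k j) (h j)⟫_ℂ := by
    intro k
    have := inner_self_eq_norm_sq_to_K (𝕜 := ℂ) (∑ j, σ.hom (D k j) (h j))
    simp only [sum_inner, inner_sum] at this
    rw [Finset.sum_comm, this]
    norm_cast
  simp only [h2]
  rw [Finset.sum_comm]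
  conv_rhs => rw [Finset.sum_comm]; enter [2, i]; rw [Finset.sum_comm]

lemma preForm_conj (σ : HilbertRep.{u} M) (x y : AlgTensor E σ) :
    starRingEnd ℂ (preForm σ y x) = preForm σ x y := by
  have h1 : ∀ (a : M) (x y : σ), ⟪σ.hom a x, y⟫_ℂ = ⟪x, σ.hom (star a) y⟫_ℂ := by
    intro a x y
    rw [map_star]
    exact (ContinuousLinearMap.adjoint_inner_right (σ.hom a) x y).symm
  induction x using AlgTensor.induction_on with
  | h0 => simp
  | h1 ξ h =>
    induction y using AlgTensor.induction_on with
    | h0 => simp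
    | h1 ζ k => rw [preForm_tmul, preForm_tmul, inner_conj_symm, h1, star_ip]
    | h2 y y' hy hy' => rw [map_add, LinearMap.add_apply, map_add, hy, hy', map_add]
  | h2 x x' hx hx' => rw [map_add, map_add, hx, hx', map_add, LinearMap.add_apply]

/-- The form on `E ⊙ H` is positive semidefinite. -/
abbrev preCore (E : Type u) [NormedAddCommGroup E] [NormedSpace ℂ E] [Module Mᵐᵒᵖ E]
    [HilbertModule M E] (σ : HilbertRep.{u} M) : PreInnerProductSpace.Core ℂ (AlgTensor E σ) where
  inner x y := preForm σ x y
  conj_inner_symm x y := preForm_conj σ x y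
  re_inner_nonneg x := by
    classical
    obtain ⟨ι, _, ξ, h, rfl⟩ := AlgTensor.exists_sum σ x
    obtain ⟨D, hD⟩ := exists_gram_factor (M := M) ξ
    rw [preForm_sum_self σ ξ h D hD]
    rw [RCLike.re_eq_complex_re, Complex.ofReal_re]
    exact Finset.sum_nonneg fun _ _ => sq_nonneg _
  add_left x y z := by rw [map_add]; rfl
  smul_left x y c := by rw [map_smulₛₗ]; rfl

instance (σ : HilbertRep.{u} M) : SeminormedAddCommGroup (AlgTensor E σ) :=
  InnerProductSpace.Core.toSeminormedAddCommGroup (c := preCore E σ)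

instance (σ : HilbertRep.{u} M) : InnerProductSpace ℂ (AlgTensor E σ) :=
  InnerProductSpace.ofCore (preCore E σ)

lemma AlgTensor.inner_def (σ : HilbertRep.{u} M) (x y : AlgTensor E σ) :
    ⟪x, y⟫_ℂ = preForm σ x y := rfl

lemma AlgTensor.norm_sq_sum (σ : HilbertRep.{u} M) {ι : Type*} [Fintype ι] (ξ : ι → E) (h : ι → σ)
    (D : ι → ι → M) (hD : ∀ i j, (ip (ξ i) (ξ j) : M) = ∑ k, star (D k i) * D k j) :
    ‖∑ i, AlgTensor.tmul σ (ξ i) (h i)‖ ^ 2 = ∑ k, ‖∑ j, σ.hom (D k j) (h j)‖ ^ 2 := by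
  have := inner_self_eq_norm_sq_to_K (𝕜 := ℂ) (∑ i, AlgTensor.tmul σ (ξ i) (h i))
  rw [AlgTensor.inner_def, preForm_sum_self σ ξ h D hD] at this
  have h2 := (Complex.ofReal_pow ‖∑ i, AlgTensor.tmul σ (ξ i) (h i)‖ 2).trans this.symm
  exact Complex.ofReal_injective h2

/-- The linear map `I_E ⊗ X` on `E ⊙ H`. -/
def AlgTensor.idMap {σ τ : HilbertRep.{u} M} (X : Intertwiner σ τ) :
    AlgTensor E σ →ₗ[ℂ] AlgTensor E τ :=
  (TensorProduct.map LinearMap.id (X.toCLM : σ →ₗ[ℂ] τ) :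
    E ⊗[ℂ] (σ : Type u) →ₗ[ℂ] E ⊗[ℂ] (τ : Type u))

lemma AlgTensor.idMap_tmul {σ τ : HilbertRep.{u} M} (X : Intertwiner σ τ) (ξ : E) (h : σ) :
    AlgTensor.idMap X (AlgTensor.tmul σ ξ h) = AlgTensor.tmul τ ξ (X.toCLM h) := rfl

lemma AlgTensor.norm_idMap_le {σ τ : HilbertRep.{u} M} (X : Intertwiner σ τ) (x : AlgTensor E σ) :
    ‖AlgTensor.idMap X x‖ ≤ ‖X.toCLM‖ * ‖x‖ := by
  classical
  obtain ⟨ι, _, ξ, h, rfl⟩ := AlgTensor.exists_sum σ x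
  obtain ⟨D, hD⟩ := exists_gram_factor (M := M) ξ
  refine (sq_le_sq₀ (norm_nonneg _) (by positivity)).mp ?_
  rw [map_sum, mul_pow]
  simp only [AlgTensor.idMap_tmul]
  rw [AlgTensor.norm_sq_sum τ ξ _ D hD, AlgTensor.norm_sq_sum σ ξ _ D hD, Finset.mul_sum]
  refine Finset.sum_le_sum fun k _ => ?_
  rw [← mul_pow]
  have : ∑ j, τ.hom (D k j) (X.toCLM (h j)) = X.toCLM (∑ j, σ.hom (D k j) (h j)) := by
    rw [map_sum]
    exact Finset.sum_congr rfl fun j _ => (X.comm _ _).symm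
  rw [this]
  gcongr
  exact X.toCLM.le_opNorm _

/-- The linear map `φ(a) ⊗ I_H` on `E ⊙ H`. -/
def AlgTensor.actMap (φ : LeftAction M E) (σ : HilbertRep.{u} M) (a : M) :
    AlgTensor E σ →ₗ[ℂ] AlgTensor E σ :=
  (TensorProduct.map (φ.toHom a : E →ₗ[ℂ] E) LinearMap.id :
    E ⊗[ℂ] (σ : Type u) →ₗ[ℂ] E ⊗[ℂ] (σ : Type u))

lemma AlgTensor.actMap_tmul (φ : LeftAction M E) (σ : HilbertRep.{u} M) (a : M) (ξ : E) (h : σ) :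
    AlgTensor.actMap φ σ a (AlgTensor.tmul σ ξ h) = AlgTensor.tmul σ (φ.toHom a ξ) h := rfl

lemma AlgTensor.tmul_add_left (σ : HilbertRep.{u} M) (ξ ξ' : E) (h : σ) :
    AlgTensor.tmul σ (ξ + ξ') h = AlgTensor.tmul σ ξ h + AlgTensor.tmul σ ξ' h :=
  TensorProduct.add_tmul ξ ξ' h

lemma AlgTensor.smul_tmul_left (σ : HilbertRep.{u} M) (c : ℂ) (ξ : E) (h : σ) :
    AlgTensor.tmul σ (c • ξ) h = c • AlgTensor.tmul σ ξ h :=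
  TensorProduct.smul_tmul' c ξ h

lemma AlgTensor.actMap_mul (φ : LeftAction M E) (σ : HilbertRep.{u} M) (a b : M)
    (x : AlgTensor E σ) :
    AlgTensor.actMap φ σ (a * b) x = AlgTensor.actMap φ σ a (AlgTensor.actMap φ σ b x) := by
  induction x using AlgTensor.induction_on with
  | h0 => simp
  | h1 ξ h => simp only [AlgTensor.actMap_tmul, map_mul]; rfl
  | h2 x y hx hy => simp only [map_add, hx, hy]

lemma AlgTensor.actMap_add (φ : LeftAction M E) (σ : HilbertRep.{u} M) (a b : M)
    (x : AlgTensor E σ) :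
    AlgTensor.actMap φ σ (a + b) x = AlgTensor.actMap φ σ a x + AlgTensor.actMap φ σ b x := by
  induction x using AlgTensor.induction_on with
  | h0 => simp
  | h1 ξ h =>
    simp only [AlgTensor.actMap_tmul, map_add, ← AlgTensor.tmul_add_left]; rfl
  | h2 x y hx hy => simp only [map_add, hx, hy]; abel

lemma AlgTensor.actMap_algebraMap (φ : LeftAction M E) (σ : HilbertRep.{u} M) (c : ℂ)
    (x : AlgTensor E σ) : AlgTensor.actMap φ σ (algebraMap ℂ M c) x = c • x := by
  induction x using AlgTensor.induction_on with
  | h0 => simp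
  | h1 ξ h =>
    rw [AlgTensor.actMap_tmul, AlgHom.commutes, ← AlgTensor.smul_tmul_left]; rfl
  | h2 x y hx hy => simp only [map_add, hx, hy, smul_add]

lemma AlgTensor.inner_actMap (φ : LeftAction M E) (σ : HilbertRep.{u} M) (a : M)
    (x y : AlgTensor E σ) :
    ⟪AlgTensor.actMap φ σ a x, y⟫_ℂ = ⟪x, AlgTensor.actMap φ σ (star a) y⟫_ℂ := by
  induction x using AlgTensor.induction_on with
  | h0 => simp
  | h1 ξ h =>
    induction y using AlgTensor.induction_on with
    | h0 => simp
    | h1 ζ k =>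
      simp only [AlgTensor.actMap_tmul, AlgTensor.inner_def, preForm_tmul, φ.ip_left]
    | h2 y y' hy hy' => rw [inner_add_right, hy, hy', map_add, inner_add_right]
  | h2 x x' hx hx' => rw [map_add, inner_add_left, hx, hx', inner_add_left]

lemma AlgTensor.norm_actMap_le (φ : LeftAction M E) (σ : HilbertRep.{u} M) (a : M)
    (x : AlgTensor E σ) : ‖AlgTensor.actMap φ σ a x‖ ≤ ‖a‖ * ‖x‖ := by
  have h1 : 0 ≤ algebraMap ℝ M (‖a‖ ^ 2) - star a * a :=
    sub_nonneg.mpr CStarAlgebra.star_mul_le_algebraMap_norm_sq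
  obtain ⟨b, hb⟩ := CStarAlgebra.nonneg_iff_eq_star_mul_self.mp h1
  have h2 : algebraMap ℂ M ((‖a‖ ^ 2 : ℝ) : ℂ) = star a * a + star b * b := by
    rw [← hb]
    simp [Algebra.algebraMap_eq_smul_one, ← Complex.coe_smul]
  have h3 : ∀ c : M, ⟪x, AlgTensor.actMap φ σ (star c * c) x⟫_ℂ =
      ((‖AlgTensor.actMap φ σ c x‖ ^ 2 : ℝ) : ℂ) := fun c => by
    rw [AlgTensor.actMap_mul, ← AlgTensor.inner_actMap, inner_self_eq_norm_sq_to_K]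
    exact (Complex.ofReal_pow _ 2).symm
  have h4 := congrArg (fun m => ⟪x, AlgTensor.actMap φ σ m x⟫_ℂ) h2
  simp only [AlgTensor.actMap_algebraMap, AlgTensor.actMap_add, inner_add_right, h3,
    inner_smul_right, inner_self_eq_norm_sq_to_K] at h4
  have h5 : ‖a‖ ^ 2 * ‖x‖ ^ 2 =
      ‖AlgTensor.actMap φ σ a x‖ ^ 2 + ‖AlgTensor.actMap φ σ b x‖ ^ 2 := by
    apply Complex.ofReal_injective
    rw [Complex.ofReal_mul, Complex.ofReal_add, ← h4]
    congr 1
    exact Complex.ofReal_pow _ 2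
  refine (sq_le_sq₀ (norm_nonneg _) (by positivity)).mp ?_
  rw [mul_pow, h5]
  exact le_add_of_nonneg_right (sq_nonneg _)

/-- The elements of `M` act on the completion of `E ⊙ H` through `φ(a) ⊗ I_H`. -/
def tensorHom (φ : LeftAction M E) (σ : HilbertRep.{u} M) :
    M →⋆ₐ[ℂ] (UniformSpace.Completion (AlgTensor E σ) →L[ℂ]
      UniformSpace.Completion (AlgTensor E σ)) where
  toFun a := ((AlgTensor.actMap φ σ a).mkContinuous ‖a‖ (AlgTensor.norm_actMap_le φ σ a)).completion
  map_zero' := by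
    ext x
    induction x using UniformSpace.Completion.induction_on with
    | hp => apply isClosed_eq <;> fun_prop
    | ih x =>
      have := AlgTensor.actMap_algebraMap φ σ 0 x
      rw [map_zero, zero_smul] at this
      simp [this, UniformSpace.Completion.coe_zero]
  map_one' := by
    ext x
    induction x using UniformSpace.Completion.induction_on with
    | hp => apply isClosed_eq <;> fun_prop
    | ih x =>
      have := AlgTensor.actMap_algebraMap φ σ 1 x
      rw [map_one, one_smul] at this
      simp [this]
  map_add' a b := by
    ext x
    induction x using UniformSpace.Completion.induction_on with
    | hp => apply isClosed_eq <;> fun_prop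
    | ih x => simp [AlgTensor.actMap_add, UniformSpace.Completion.coe_add]
  map_mul' a b := by
    ext x
    induction x using UniformSpace.Completion.induction_on with
    | hp => apply isClosed_eq <;> fun_prop
    | ih x => simp [AlgTensor.actMap_mul]
  commutes' c := by
    ext x
    induction x using UniformSpace.Completion.induction_on with
    | hp => apply isClosed_eq <;> fun_prop
    | ih x =>
      have := AlgTensor.actMap_algebraMap φ σ c x
      rw [Algebra.algebraMap_eq_smul_one] at this
      simp [Algebra.algebraMap_eq_smul_one, this, UniformSpace.Completion.coe_smul]
  map_star' a := by
    refine (ContinuousLinearMap.eq_adjoint_iff _ _).mpr fun x y => ?_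
    induction x, y using UniformSpace.Completion.induction_on₂ with
    | hp => apply isClosed_eq <;> fun_prop
    | ih x y => simp [AlgTensor.inner_actMap]

/-- The Hilbert space `E ⊗_σ H`, with `a ∈ M` acting as `φ(a) ⊗ I_H`. -/
def HilbertRep.tensor (φ : LeftAction M E) (σ : HilbertRep.{u} M) : HilbertRep.{u} M where
  Space := UniformSpace.Completion (AlgTensor E σ)
  hom := tensorHom φ σ

lemma idMap_completion_comm (φ : LeftAction M E) {σ τ : HilbertRep.{u} M} (X : Intertwiner σ τ)
    (a : M) (x : UniformSpace.Completion (AlgTensor E σ)) :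
    ((AlgTensor.idMap (E := E) X).mkContinuous ‖X.toCLM‖
      (AlgTensor.norm_idMap_le X)).completion (tensorHom φ σ a x) =
    tensorHom φ τ a (((AlgTensor.idMap (E := E) X).mkContinuous ‖X.toCLM‖
      (AlgTensor.norm_idMap_le X)).completion x) := by
  induction x using UniformSpace.Completion.induction_on with
  | hp => apply isClosed_eq <;> fun_prop
  | ih x =>
    have : AlgTensor.idMap X (AlgTensor.actMap φ σ a x) =
        AlgTensor.actMap φ τ a (AlgTensor.idMap X x) := by
      induction x using AlgTensor.induction_on with
      | h0 => simp
      | h1 ξ h => rfl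
      | h2 x y hx hy => simp only [map_add, hx, hy]
    simp [tensorHom, this]

/-- `I_E ⊗ X : E ⊗_σ H → E ⊗_τ K` for an intertwiner `X : H → K`. -/
def Intertwiner.tensor (φ : LeftAction M E) {σ τ : HilbertRep.{u} M} (X : Intertwiner σ τ) :
    Intertwiner (σ.tensor φ) (τ.tensor φ) where
  toCLM := ((AlgTensor.idMap (E := E) X).mkContinuous ‖X.toCLM‖
    (AlgTensor.norm_idMap_le X)).completion
  comm a x := idMap_completion_comm φ X a x

lemma Intertwiner.norm_tensor_le (φ : LeftAction M E) {σ τ : HilbertRep.{u} M}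
    (X : Intertwiner σ τ) : ‖(X.tensor φ).toCLM‖ ≤ ‖X.toCLM‖ := by
  refine ContinuousLinearMap.opNorm_le_bound _ (norm_nonneg _) fun x => ?_
  change UniformSpace.Completion (AlgTensor E σ) at x
  change ‖((AlgTensor.idMap (E := E) X).mkContinuous ‖X.toCLM‖
    (AlgTensor.norm_idMap_le X)).completion x‖ ≤ ‖X.toCLM‖ * ‖x‖
  induction x using UniformSpace.Completion.induction_on with
  | hp => apply isClosed_le <;> fun_prop
  | ih x => simpa using AlgTensor.norm_idMap_le X x

lemma norm_hom_le (σ : HilbertRep.{u} M) (a : M) : ‖σ.hom a‖ ≤ ‖a‖ :=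
  NonUnitalStarAlgHom.norm_apply_le σ.hom a

lemma AlgTensor.norm_tmul_le (σ : HilbertRep.{u} M) (ξ : E) (h : σ) :
    ‖AlgTensor.tmul σ ξ h‖ ≤ ‖ξ‖ * ‖h‖ := by
  refine (sq_le_sq₀ (norm_nonneg _) (by positivity)).mp ?_
  rw [← inner_self_eq_norm_sq (𝕜 := ℂ), AlgTensor.inner_def, preForm_tmul, mul_pow,
    norm_sq (M := M) ξ]
  calc RCLike.re ⟪h, σ.hom (ip ξ ξ) h⟫_ℂ ≤ ‖h‖ * ‖σ.hom (ip ξ ξ) h‖ := re_inner_le_norm _ _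
    _ ≤ ‖h‖ * (‖(ip ξ ξ : M)‖ * ‖h‖) := by
      gcongr
      exact (σ.hom (ip ξ ξ)).le_of_opNorm_le (norm_hom_le σ _) h
    _ = ‖(ip ξ ξ : M)‖ * ‖h‖ ^ 2 := by ring

/-- The operator `h ↦ ξ ⊗ h` from `H` to the completion of `E ⊙ H`. -/
def creationMap (σ : HilbertRep.{u} M) (ξ : E) :
    σ →L[ℂ] UniformSpace.Completion (AlgTensor E σ) :=
  LinearMap.mkContinuous
    { toFun := fun h => ((AlgTensor.tmul σ ξ h : AlgTensor E σ) :
        UniformSpace.Completion (AlgTensor E σ))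
      map_add' := fun h k => by
        rw [← UniformSpace.Completion.coe_add]
        exact congrArg _ (TensorProduct.tmul_add ξ h k)
      map_smul' := fun c h => by
        rw [RingHom.id_apply, ← UniformSpace.Completion.coe_smul]
        exact congrArg _ (TensorProduct.tmul_smul c ξ h) }
    ‖ξ‖ fun h => (UniformSpace.Completion.norm_coe _).trans_le (AlgTensor.norm_tmul_le σ ξ h)

/-- The operator `h ↦ ξ ⊗ h` from `H` to `E ⊗_σ H`. -/
def creation (φ : LeftAction M E) (σ : HilbertRep.{u} M) (ξ : E) : σ →L[ℂ] σ.tensor φ :=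
  creationMap σ ξ

/-! ### Tensor powers and the Fock space -/

/-- The Hilbert space `E^{⊗n} ⊗_σ H` with the left action of `M`, where `M ⊗_σ H = H` and
`E^{⊗(n+1)} ⊗_σ H = E ⊗ (E^{⊗n} ⊗_σ H)` by the usual identifications. -/
def HilbertRep.power (φ : LeftAction M E) (σ : HilbertRep.{u} M) : ℕ → HilbertRep.{u} M
  | 0 => σ
  | n + 1 => (HilbertRep.power φ σ n).tensor φ

/-- `I_{E^{⊗n}} ⊗ X`. -/
def Intertwiner.power (φ : LeftAction M E) {σ τ : HilbertRep.{u} M} (X : Intertwiner σ τ) :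
    (n : ℕ) → Intertwiner (σ.power φ n) (τ.power φ n)
  | 0 => X
  | n + 1 => (Intertwiner.power φ X n).tensor φ

lemma Intertwiner.norm_power_le (φ : LeftAction M E) {σ τ : HilbertRep.{u} M}
    (X : Intertwiner σ τ) : ∀ n, ‖(X.power φ n).toCLM‖ ≤ ‖X.toCLM‖
  | 0 => le_rfl
  | n + 1 => ((X.power φ n).norm_tensor_le φ).trans (Intertwiner.norm_power_le φ X n)

/-- The Hilbert space `𝓕(E) ⊗_σ H`, the Hilbert space direct sum of the `E^{⊗n} ⊗_σ H`. -/
abbrev Fock (φ : LeftAction M E) (σ : HilbertRep.{u} M) : Type u :=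
  lp (fun n : ℕ => (σ.power φ n : Type u)) 2

/-- `I_{𝓕(E)} ⊗ X`. -/
def Intertwiner.fock (φ : LeftAction M E) {σ τ : HilbertRep.{u} M} (X : Intertwiner σ τ) :
    Fock φ σ →L[ℂ] Fock φ τ :=
  lp.mapCLM 2 (fun n => (X.power φ n).toCLM) (norm_nonneg X.toCLM) (X.norm_power_le φ)

/-- The diagonal left action `φ_∞(a) ⊗ I` of `a ∈ M` on `𝓕(E) ⊗_π K`. -/
def inducedHom (φ : LeftAction M E) (π : HilbertRep.{u} M) (a : M) : Fock φ π →L[ℂ] Fock φ π :=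
  lp.mapCLM 2 (fun n => (π.power φ n).hom a) (norm_nonneg a) fun n => norm_hom_le (π.power φ n) a

/-- The sequence `(0, ξ ⊗ f 0, ξ ⊗ f 1, …)`. -/
def shiftFun (φ : LeftAction M E) (π : HilbertRep.{u} M) (ξ : E)
    (f : (n : ℕ) → π.power φ n) : (n : ℕ) → π.power φ n
  | 0 => 0
  | n + 1 => creation φ (π.power φ n) ξ (f n)

lemma norm_creation_le (φ : LeftAction M E) (σ : HilbertRep.{u} M) (ξ : E) (h : σ) :
    ‖creation φ σ ξ h‖ ≤ ‖ξ‖ * ‖h‖ :=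
  (UniformSpace.Completion.norm_coe _).trans_le (AlgTensor.norm_tmul_le σ ξ h)

lemma sum_shiftFun_le (φ : LeftAction M E) (π : HilbertRep.{u} M) (ξ : E) (f : Fock φ π) :
    Summable (fun n => ‖shiftFun φ π ξ f n‖ ^ 2) ∧
      ∑' n, ‖shiftFun φ π ξ f n‖ ^ 2 ≤ ‖ξ‖ ^ 2 * ∑' n, ‖f n‖ ^ 2 := by
  have hf : Summable (fun n => ‖f n‖ ^ 2) := by
    simpa using (lp.memℓp f).summable (by norm_num)
  have hle : ∀ n, ‖shiftFun φ π ξ f (n + 1)‖ ^ 2 ≤ ‖ξ‖ ^ 2 * ‖f n‖ ^ 2 := fun n => by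
    rw [← mul_pow]
    exact pow_le_pow_left₀ (norm_nonneg _) (norm_creation_le φ (π.power φ n) ξ (f n)) 2
  have h1 : Summable (fun n => ‖shiftFun φ π ξ f (n + 1)‖ ^ 2) :=
    Summable.of_nonneg_of_le (fun n => sq_nonneg _) hle (hf.mul_left _)
  have h2 : Summable (fun n => ‖shiftFun φ π ξ f n‖ ^ 2) := (summable_nat_add_iff 1).mp h1
  refine ⟨h2, ?_⟩
  rw [h2.tsum_eq_zero_add, ← tsum_mul_left]
  have h0 : ‖shiftFun φ π ξ f 0‖ ^ 2 = 0 := by simp [shiftFun]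
  rw [h0, zero_add]
  exact h1.tsum_le_tsum hle (hf.mul_left _)

/-- The creation operator `T_ξ ⊗ I` on `𝓕(E) ⊗_π K`. -/
def inducedCreation (φ : LeftAction M E) (π : HilbertRep.{u} M) (ξ : E) :
    Fock φ π →L[ℂ] Fock φ π :=
  LinearMap.mkContinuous
    { toFun := fun f => ⟨shiftFun φ π ξ f, memℓp_gen (by
        simpa using (sum_shiftFun_le φ π ξ f).1)⟩
      map_add' := fun f g => by
        ext n
        cases n with
        | zero => exact (add_zero _).symm
        | succ n => exact map_add (creation φ (π.power φ n) ξ) (f n) (g n)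
      map_smul' := fun c f => by
        ext n
        cases n with
        | zero => exact (smul_zero _).symm
        | succ n => exact map_smul (creation φ (π.power φ n) ξ) c (f n) }
    ‖ξ‖ fun f => by
      refine (sq_le_sq₀ (norm_nonneg _) (by positivity)).mp ?_
      have h : ∀ g : Fock φ π, ‖g‖ ^ 2 = ∑' n, ‖g n‖ ^ 2 := fun g => by
        simpa using lp.norm_rpow_eq_tsum (by norm_num) g
      rw [mul_pow, h, h]
      exact (sum_shiftFun_le φ π ξ f).2

/-! ### Covariant representations, the completely positive map, superharmonic operators -/

/-- The `σ`-dual `E^σ = 𝓘(σ, σ^E ∘ φ)`. -/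
abbrev SigmaDual (φ : LeftAction M E) (σ : HilbertRep.{u} M) := Intertwiner σ (σ.tensor φ)

/-- The map `ξ ↦ η̂*(ξ)`, `η̂*(ξ) h = η*(ξ ⊗ h)`, from `E` to `B(H)`. -/
def covRep (φ : LeftAction M E) {σ : HilbertRep.{u} M} (η : SigmaDual φ σ) (ξ : E) : σ →L[ℂ] σ :=
  ContinuousLinearMap.adjoint η.toCLM ∘L creation φ σ ξ

/-- The completely positive map `Φ_η(a) = η* (I_E ⊗ a) η` on `σ(M)'`. -/
def cpMap (φ : LeftAction M E) {σ : HilbertRep.{u} M} (η : SigmaDual φ σ) (a : Commutant σ) :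
    Commutant σ :=
  η.adj.comp ((a.tensor φ).comp η)

/-- The generalized powers `η_n : H → E^{⊗n} ⊗_σ H`: `η_0 = I` and `η_{n+1} = (I_E ⊗ η_n) η`. -/
def genPower (φ : LeftAction M E) {σ : HilbertRep.{u} M} (η : SigmaDual φ σ) :
    (n : ℕ) → Intertwiner σ (σ.power φ n)
  | 0 => ⟨ContinuousLinearMap.id ℂ σ, fun _ _ => rfl⟩
  | n + 1 => ((genPower φ η n).tensor φ).comp η

/-- `𝓘((S, ρ), (T, σ))`: the bounded operators `C : K → H` with `C ρ(a) = σ(a) C` for `a ∈ M` and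
`C S(ξ) = T(ξ) C` for `ξ ∈ E`. -/
def pairIntertwiners {K H : Type u} [NormedAddCommGroup K] [InnerProductSpace ℂ K]
    [NormedAddCommGroup H] [InnerProductSpace ℂ H]
    (S : E → K →L[ℂ] K) (ρ : M → K →L[ℂ] K) (T : E → H →L[ℂ] H) (σ : M → H →L[ℂ] H) :
    Set (K →L[ℂ] H) :=
  {C | (∀ a, C ∘L ρ a = σ a ∘L C) ∧ ∀ ξ, C ∘L S ξ = T ξ ∘L C}

/-- `𝓘((S₀, σ₀), (η̂*, σ))`, where `(S₀, σ₀)` is the covariant representation on `𝓕(E) ⊗_π K`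
induced by `π`. -/
def inducedIntertwiners (φ : LeftAction M E) (π : HilbertRep.{u} M) {σ : HilbertRep.{u} M}
    (η : SigmaDual φ σ) : Set (Fock φ π →L[ℂ] σ) :=
  pairIntertwiners (inducedCreation φ π) (inducedHom φ π) (covRep φ η) σ.hom

end Hilbert

end Tensor

section Superharmonic

variable {M : Type w} [CStarAlgebra M] {σ : HilbertRep.{u} M}

/-- `Q` is superharmonic for `Φ`: `Q ≥ 0` and `Φ(Q) ≤ Q`. -/
structure IsSuperharmonic (Φ : Commutant σ → Commutant σ) (Q : Commutant σ) : Prop where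
  nonneg : 0 ≤ Q.toCLM
  map_le : (Φ Q).toCLM ≤ Q.toCLM

/-- `Q` is pure superharmonic for `Φ`: moreover `Φ^n(Q) → 0` strongly. -/
structure IsPureSuperharmonic (Φ : Commutant σ → Commutant σ) (Q : Commutant σ) : Prop
    extends IsSuperharmonic Φ Q where
  tendsto_zero : ∀ x : σ, Tendsto (fun n => (Φ^[n] Q).toCLM x) atTop (𝓝 0)

/-- The operator `(Q - Φ(Q))^{1/2}` in `σ(M)'`. -/
def sqrtDefect (Φ : Commutant σ → Commutant σ) (Q : Commutant σ) : Commutant σ where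
  toCLM := CFC.sqrt (Q.toCLM - (Φ Q).toCLM)
  comm a x := by
    have h : Commute (Q.toCLM - (Φ Q).toCLM) (σ.hom a) := by
      refine Commute.sub_left ?_ ?_
      · ext x; exact Q.comm a x
      · ext x; exact (Φ Q).comm a x
    exact congrArg (fun T : σ →L[ℂ] σ => T x) (h.cfcₙ_nnreal NNReal.sqrt).eq

end Superharmonic

end

end WCorr
open WCorr

namespace WCorr

noncomputable section

universe u v w

/-! For an intertwiner `c` from `σ` to `π` put c_n = (I ⊗ c) η_n (`poissonCoeff`). Then c_n* c_n =
Φ^n(c* c), where Φ = Φ_η. If c* c = Q - Φ(Q), the partial sums of c_n* c_n telescope to Q - Φ^N(Q),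
so purity says exactly that they increase strongly to Q. Hence B x = (c_n x)_n is bounded with B* B
= Q, and the recursion c_{n+1} = (I ⊗ c_n) η is the covariance relation for C = B* read on adjoints
(`poissonKernel_adjoint_mem`).

Conversely, covariance of C forces that recursion on the coefficients of C*, because adjoint
creation operators separate the vectors of E ⊗ H; so C* is the family (c_n) built from its
degree-zero coefficient c (`exists_poissonCoeff_eq`). If C C* = Q, then Q is the strong sum of the
c_n* c_n, and Φ shifts this sum by one term: Q - Φ(Q) = c* c, and Φ^N(Q) is a tail tending to 0
(`defect_of_poissonKernel`). Since c* c = r², polar decomposition gives c = v r, which accounts for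
all choices of v (`exists_partialIsometry`).

It remains to see that some v exists for a given pure Q. By `exists_isometric_intertwiner`, σ embeds
isometrically in π: a Hahn-Banach argument in the predual shows that every normal functional is a
single matrix coefficient of π (`exists_coeff`), so every vector of H is hit by a contractive
intertwiner from π. Combining the adjoints of countably many of these gives an injective
intertwiner, whose polar part is an isometry. -/

lemma lp_two_norm_sq {ι : Type*} {G : ι → Type*} [∀ i, NormedAddCommGroup (G i)] (f : lp G 2) :
    ‖f‖ ^ 2 = ∑' n, ‖f n‖ ^ 2 := by
  simpa using lp.norm_rpow_eq_tsum (by norm_num) f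

/-! ### Functoriality of E ⊗ (·): composition, adjoints, strong limits. -/

section Functoriality

variable {M : Type w} [CStarAlgebra M]

lemma Intertwiner.ext_toCLM {σ τ : HilbertRep.{u} M} {X Y : Intertwiner σ τ}
    (h : X.toCLM = Y.toCLM) : X = Y := by
  cases X; cases Y; cases h; rfl

lemma HilbertRep.inner_hom_left (σ : HilbertRep.{u} M) (a : M) (x y : σ) :
    ⟪σ.hom a x, y⟫_ℂ = ⟪x, σ.hom (star a) y⟫_ℂ := by
  rw [map_star]
  exact (ContinuousLinearMap.adjoint_inner_right (σ.hom a) x y).symm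

lemma HilbertRep.adjoint_hom (σ : HilbertRep.{u} M) (a : M) :
    ContinuousLinearMap.adjoint (σ.hom a) = σ.hom (star a) := by
  rw [map_star]; rfl

lemma Intertwiner.adj_comp {σ τ ρ : HilbertRep.{u} M} (Y : Intertwiner τ ρ) (X : Intertwiner σ τ) :
    (Y.comp X).adj = X.adj.comp Y.adj :=
  Intertwiner.ext_toCLM (ContinuousLinearMap.adjoint_comp _ _)

lemma inner_adj_comp_self {σ τ : HilbertRep.{u} M} (X : Intertwiner σ τ) (x : σ) :
    ⟪x, (X.adj.comp X).toCLM x⟫_ℂ = ((‖X.toCLM x‖ ^ 2 : ℝ) : ℂ) := by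
  refine (ContinuousLinearMap.adjoint_inner_right X.toCLM x (X.toCLM x)).trans ?_
  rw [inner_self_eq_norm_sq_to_K]
  exact (Complex.ofReal_pow _ 2).symm

variable [PartialOrder M] [StarOrderedRing M]
  {E : Type u} [NormedAddCommGroup E] [NormedSpace ℂ E] [Module Mᵐᵒᵖ E] [HilbertModule M E]
  (φ : LeftAction M E) {σ τ ρ : HilbertRep.{u} M}

lemma tensor_toCLM_creation (X : Intertwiner σ τ) (ξ : E) (h : σ) :
    (X.tensor φ).toCLM (creation φ σ ξ h) = creation φ τ ξ (X.toCLM h) := by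
  change ((AlgTensor.idMap (E := E) X).mkContinuous ‖X.toCLM‖
    (AlgTensor.norm_idMap_le X)).completion
      ((AlgTensor.tmul σ ξ h : AlgTensor E σ) : UniformSpace.Completion (AlgTensor E σ)) =
    ((AlgTensor.tmul τ ξ (X.toCLM h) : AlgTensor E τ) : UniformSpace.Completion (AlgTensor E τ))
  simp [AlgTensor.idMap_tmul]

lemma inner_creation (ξ ζ : E) (h k : σ) :
    ⟪creation φ σ ξ h, creation φ σ ζ k⟫_ℂ = ⟪h, σ.hom (HilbertModule.ip ξ ζ) k⟫_ℂ := by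
  refine (UniformSpace.Completion.inner_coe (𝕜 := ℂ) (AlgTensor.tmul σ ξ h)
    (AlgTensor.tmul σ ζ k)).trans ?_
  rw [AlgTensor.inner_def, preForm_tmul]

/-- The elementary tensors span a dense subspace of `E ⊗_σ H`. -/
lemma tensor_induction {P : σ.tensor φ → Prop} (hc : IsClosed {x | P x}) (h0 : P 0)
    (h1 : ∀ ξ h, P (creation φ σ ξ h)) (h2 : ∀ x y, P x → P y → P (x + y)) (x : σ.tensor φ) :
    P x := by
  refine UniformSpace.Completion.induction_on (α := AlgTensor E σ)
    (p := fun x : UniformSpace.Completion (AlgTensor E σ) => P x) x hc fun y => ?_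
  induction y using AlgTensor.induction_on with
  | h0 => exact h0
  | h1 ξ h => exact h1 ξ h
  | h2 x y hx hy =>
    have := h2 _ _ hx hy
    rw [UniformSpace.Completion.coe_add]
    exact this

lemma tensor_ext {F : Type*} [NormedAddCommGroup F] [NormedSpace ℂ F] {S T : σ.tensor φ →L[ℂ] F}
    (h : ∀ ξ x, S (creation φ σ ξ x) = T (creation φ σ ξ x)) : S = T := by
  ext x
  refine tensor_induction φ (P := fun x => S x = T x) (isClosed_eq S.continuous T.continuous)
    (by simp) h (fun x y hx hy => by simp [hx, hy]) x

/-- A vector of `E ⊗_σ H` is determined by its images under the adjoint creation operators. -/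
lemma eq_of_adjoint_creation_eq {x y : σ.tensor φ}
    (h : ∀ ξ, ContinuousLinearMap.adjoint (creation φ σ ξ) x =
      ContinuousLinearMap.adjoint (creation φ σ ξ) y) : x = y := by
  refine ext_inner_left ℂ fun z => ?_
  refine tensor_induction φ (P := fun z => ⟪z, x⟫_ℂ = ⟪z, y⟫_ℂ)
    (isClosed_eq (by fun_prop) (by fun_prop)) (by simp) (fun ξ k => ?_)
    (fun z z' hz hz' => by simp [hz, hz']) z
  rw [← ContinuousLinearMap.adjoint_inner_right, h, ContinuousLinearMap.adjoint_inner_right]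

lemma Intertwiner.tensor_comp (Y : Intertwiner τ ρ) (X : Intertwiner σ τ) :
    (Y.comp X).tensor φ = (Y.tensor φ).comp (X.tensor φ) :=
  Intertwiner.ext_toCLM <| tensor_ext φ fun ξ x => by
    simp [Intertwiner.comp, tensor_toCLM_creation]

/-- Tested on elementary tensors, both sides pair to ⟨x, X σ(⟨ξ, ζ⟩) k⟩; the intertwining property
is what lets `X` pass the inner product of `E`. -/
lemma Intertwiner.adj_tensor (X : Intertwiner σ τ) : X.adj.tensor φ = (X.tensor φ).adj := by
  refine Intertwiner.ext_toCLM <| tensor_ext φ fun ξ x => ?_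
  rw [tensor_toCLM_creation]
  refine ext_inner_right ℂ fun z => ?_
  refine tensor_induction φ (P := fun z => ⟪creation φ σ ξ (X.adj.toCLM x), z⟫_ℂ =
    ⟪(X.tensor φ).adj.toCLM (creation φ τ ξ x), z⟫_ℂ)
    (isClosed_eq (by fun_prop) (by fun_prop)) (by simp) (fun ζ k => ?_)
    (fun z z' hz hz' => by simp [hz, hz']) z
  change _ = ⟪ContinuousLinearMap.adjoint _ _, _⟫_ℂ
  rw [ContinuousLinearMap.adjoint_inner_left, tensor_toCLM_creation, inner_creation,
    inner_creation, ← X.comm]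
  exact ContinuousLinearMap.adjoint_inner_left _ _ _

lemma Intertwiner.tensor_sub {X Y Z : Intertwiner σ τ} (h : X.toCLM = Y.toCLM - Z.toCLM) :
    (X.tensor φ).toCLM = (Y.tensor φ).toCLM - (Z.tensor φ).toCLM :=
  tensor_ext φ fun ξ x => by simp [tensor_toCLM_creation, h]

/-- `X ↦ I_E ⊗ X` preserves strong convergence of sequences. -/
lemma Intertwiner.tendsto_tensor {X : ℕ → Intertwiner σ τ} {Y : Intertwiner σ τ}
    (h : ∀ x, Tendsto (fun n => (X n).toCLM x) atTop (𝓝 (Y.toCLM x))) (z : σ.tensor φ) :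
    Tendsto (fun n => ((X n).tensor φ).toCLM z) atTop (𝓝 ((Y.tensor φ).toCLM z)) := by
  -- A uniform bound on the norms makes the set of vectors where convergence holds closed, so
  -- elementary tensors suffice.
  obtain ⟨K, hK⟩ := banach_steinhaus (g := fun n => (X n).toCLM) fun x => by
    obtain ⟨K, hK⟩ := (h x).norm.bddAbove_range
    exact ⟨K, fun n => hK ⟨n, rfl⟩⟩
  have hK0 : 0 ≤ K := (norm_nonneg _).trans (hK 0)
  refine tensor_induction φ (P := fun z => Tendsto (fun n => ((X n).tensor φ).toCLM z) atTop
    (𝓝 ((Y.tensor φ).toCLM z))) ?_ (by simp) (fun ξ x => ?_)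
    (fun x y hx hy => by simpa using hx.add hy) z
  · rw [← isSeqClosed_iff_isClosed]
    intro zs z hzs hz
    rw [Set.mem_ofPred_eq, Metric.tendsto_atTop]
    intro ε hε
    have hL : 0 < K + ‖Y.toCLM‖ + 1 := by positivity
    -- `K + ‖Y.toCLM‖` bounds the effect of both operators on `z - zs m`; the extra 1 only keeps the
    -- denominator positive.
    obtain ⟨m, hm⟩ := Metric.tendsto_atTop.mp hz (ε / 2 / (K + ‖Y.toCLM‖ + 1)) (by positivity)
    obtain ⟨N, hN⟩ := Metric.tendsto_atTop.mp (hzs m) (ε / 2) (by positivity)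
    refine ⟨N, fun n hn => ?_⟩
    have h1 : ‖((X n).tensor φ).toCLM (z - zs m)‖ ≤ K * ‖z - zs m‖ :=
      ContinuousLinearMap.le_of_opNorm_le _ (((X n).norm_tensor_le φ).trans (hK n)) _
    have h2 : ‖(Y.tensor φ).toCLM (z - zs m)‖ ≤ ‖Y.toCLM‖ * ‖z - zs m‖ :=
      ContinuousLinearMap.le_of_opNorm_le _ (Y.norm_tensor_le φ) _
    have h3 := hN n hn
    have h4 := hm m le_rfl
    rw [dist_comm, dist_eq_norm, lt_div_iff₀ hL] at h4
    rw [dist_eq_norm] at h3 ⊢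
    calc _ = ‖((X n).tensor φ).toCLM (z - zs m) - (Y.tensor φ).toCLM (z - zs m) +
          (((X n).tensor φ).toCLM (zs m) - (Y.tensor φ).toCLM (zs m))‖ := by
            simp only [map_sub]; congr 1; abel
      _ ≤ _ := (norm_add_le _ _).trans (add_le_add_left (norm_sub_le _ _) _)
      _ < ε := by nlinarith [norm_nonneg (z - zs m)]
  · simp only [tensor_toCLM_creation]
    exact ((creation φ τ ξ).continuous.tendsto _).comp (h x)

lemma Intertwiner.power_comp (Y : Intertwiner τ ρ) (X : Intertwiner σ τ) :
    ∀ n, (Y.comp X).power φ n = (Y.power φ n).comp (X.power φ n)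
  | 0 => rfl
  | n + 1 => (congrArg (Intertwiner.tensor φ) (Intertwiner.power_comp Y X n)).trans
      (Intertwiner.tensor_comp φ _ _)

lemma Intertwiner.adj_power (X : Intertwiner σ τ) : ∀ n, X.adj.power φ n = (X.power φ n).adj
  | 0 => rfl
  | n + 1 => (congrArg (Intertwiner.tensor φ) (Intertwiner.adj_power X n)).trans
      (Intertwiner.adj_tensor φ _)

end Functoriality

/-! ### Poisson kernels and the telescoping identity. -/

section Poisson

variable {M : Type w} [CStarAlgebra M] [PartialOrder M] [StarOrderedRing M]
  {E : Type u} [NormedAddCommGroup E] [NormedSpace ℂ E] [Module Mᵐᵒᵖ E] [HilbertModule M E]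
  (φ : LeftAction M E) {σ τ π : HilbertRep.{u} M} (η : SigmaDual φ σ)

/-- `(I_{E^{⊗n}} ⊗ c) η_n`. -/
def poissonCoeff (c : Intertwiner σ π) (n : ℕ) : Intertwiner σ (π.power φ n) :=
  (c.power φ n).comp (genPower φ η n)

/-- Splitting off the outermost factor `E` gives the recursion that covariance imposes on the
coefficients of C*. -/
lemma poissonCoeff_succ (c : Intertwiner σ π) (n : ℕ) :
    poissonCoeff φ η c (n + 1) = ((poissonCoeff φ η c n).tensor φ).comp η := by
  refine Intertwiner.ext_toCLM ?_
  rw [poissonCoeff, poissonCoeff, Intertwiner.tensor_comp]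
  rfl

/-- This is the source of the factorization C* = (I ⊗ v) B when c = v r. -/
lemma poissonCoeff_comp (v : Intertwiner τ π) (c : Intertwiner σ τ) (n : ℕ) :
    poissonCoeff φ η (v.comp c) n = (v.power φ n).comp (poissonCoeff φ η c n) := by
  refine Intertwiner.ext_toCLM ?_
  rw [poissonCoeff, poissonCoeff, Intertwiner.power_comp]
  rfl

/-- `c_n* c_n = Φ_η^n(c* c)` for `c_n = (I ⊗ c) η_n`. -/
lemma adj_comp_poissonCoeff (c : Intertwiner σ π) (n : ℕ) :
    (poissonCoeff φ η c n).adj.comp (poissonCoeff φ η c n) = (cpMap φ η)^[n] (c.adj.comp c) := by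
  induction n with
  | zero => rfl
  | succ n ih =>
    rw [Function.iterate_succ_apply', ← ih, poissonCoeff_succ, cpMap, Intertwiner.tensor_comp,
      Intertwiner.adj_tensor]
    exact congrArg (fun Y => Y.comp (((poissonCoeff φ η c n).tensor φ).comp η))
      (Intertwiner.adj_comp ((poissonCoeff φ η c n).tensor φ) η)

lemma cpMap_sub {X Y Z : Commutant σ} (h : X.toCLM = Y.toCLM - Z.toCLM) :
    (cpMap φ η X).toCLM = (cpMap φ η Y).toCLM - (cpMap φ η Z).toCLM := by
  simp [cpMap, Intertwiner.comp, Intertwiner.tensor_sub φ h]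

lemma cpMap_iterate_sub {X Y Z : Commutant σ} (h : X.toCLM = Y.toCLM - Z.toCLM) (n : ℕ) :
    ((cpMap φ η)^[n] X).toCLM = ((cpMap φ η)^[n] Y).toCLM - ((cpMap φ η)^[n] Z).toCLM := by
  induction n with
  | zero => exact h
  | succ n ih =>
    rw [Function.iterate_succ_apply', Function.iterate_succ_apply', Function.iterate_succ_apply']
    exact cpMap_sub φ η ih

/-- Sequential strong continuity of Φ_η, needed to apply it termwise to a strongly convergent
series. -/
lemma tendsto_cpMap {X : ℕ → Commutant σ} {Y : Commutant σ}
    (h : ∀ x, Tendsto (fun n => (X n).toCLM x) atTop (𝓝 (Y.toCLM x))) (x : σ) :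
    Tendsto (fun n => (cpMap φ η (X n)).toCLM x) atTop (𝓝 ((cpMap φ η Y).toCLM x)) :=
  (η.adj.toCLM.continuous.tendsto _).comp (Intertwiner.tendsto_tensor φ h (η.toCLM x))

/-- Partial sums of `Φ^n(Q - Φ(Q))` telescope. -/
lemma sum_poissonCoeff {c : Intertwiner σ π} {Q : Commutant σ}
    (hc : (c.adj.comp c).toCLM = Q.toCLM - (cpMap φ η Q).toCLM) (N : ℕ) :
    ∑ n ∈ Finset.range N, ((poissonCoeff φ η c n).adj.comp (poissonCoeff φ η c n)).toCLM =
      Q.toCLM - ((cpMap φ η)^[N] Q).toCLM := by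
  have : ∀ n, ((poissonCoeff φ η c n).adj.comp (poissonCoeff φ η c n)).toCLM =
      ((cpMap φ η)^[n] Q).toCLM - ((cpMap φ η)^[n + 1] Q).toCLM := fun n => by
    rw [adj_comp_poissonCoeff, cpMap_iterate_sub φ η hc, Function.iterate_succ_apply]
  induction N with
  | zero => simp
  | succ N ih =>
    rw [Finset.sum_range_succ, ih, this]
    abel

/-- The partial sums are ⟨x, (Q - Φ^N(Q)) x⟩ by telescoping. Only here does the strong convergence
Φ^N(Q) → 0 enter as an assumption. -/
lemma hasSum_poissonCoeff {c : Intertwiner σ π} {Q : Commutant σ}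
    (hQ : IsPureSuperharmonic (cpMap φ η) Q)
    (hc : (c.adj.comp c).toCLM = Q.toCLM - (cpMap φ η Q).toCLM) (x : σ) :
    HasSum (fun n => ‖(poissonCoeff φ η c n).toCLM x‖ ^ 2) (RCLike.re ⟪x, Q.toCLM x⟫_ℂ) := by
  rw [hasSum_iff_tendsto_nat_of_nonneg fun n => sq_nonneg _]
  have h : ∀ N, ∑ n ∈ Finset.range N, ‖(poissonCoeff φ η c n).toCLM x‖ ^ 2 =
      RCLike.re ⟪x, Q.toCLM x - ((cpMap φ η)^[N] Q).toCLM x⟫_ℂ := fun N => by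
    have h1 := congrArg (fun T : σ →L[ℂ] σ => RCLike.re ⟪x, T x⟫_ℂ) (sum_poissonCoeff φ η hc N)
    simp only [sum_apply, inner_sum, inner_adj_comp_self, map_sum] at h1
    exact h1
  simp only [h]
  have := (tendsto_const_nhds (x := Q.toCLM x)).sub (hQ.tendsto_zero x)
  rw [sub_zero] at this
  exact (RCLike.continuous_re.tendsto _).comp ((tendsto_const_nhds (x := x)).inner this)

/-- The Poisson kernel `x ↦ ((I ⊗ c) η_n x)_n`, where `c* c = Q - Φ(Q)`. -/
lemma exists_poissonKernel {c : Intertwiner σ π} {Q : Commutant σ}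
    (hQ : IsPureSuperharmonic (cpMap φ η) Q)
    (hc : (c.adj.comp c).toCLM = Q.toCLM - (cpMap φ η Q).toCLM) :
    ∃ B : σ →L[ℂ] Fock φ π, ∀ x n, B x n = (poissonCoeff φ η c n).toCLM x := by
  have hs := hasSum_poissonCoeff φ η hQ hc
  -- The bound comes from ‖B x‖² = ⟨x, Q x⟩ ≤ ‖Q‖ ‖x‖².
  refine ⟨LinearMap.mkContinuous
    { toFun := fun x => ⟨fun n => (poissonCoeff φ η c n).toCLM x, memℓp_gen (by
        simpa using (hs x).summable)⟩
      map_add' := fun x y => by ext n; exact map_add _ x y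
      map_smul' := fun a x => by ext n; exact map_smul _ a x } (Real.sqrt ‖Q.toCLM‖) fun x => ?_,
    fun x n => rfl⟩
  refine (sq_le_sq₀ (norm_nonneg _) (by positivity)).mp ?_
  rw [lp_two_norm_sq, mul_pow, Real.sq_sqrt (norm_nonneg _)]
  refine (hs x).tsum_eq.trans_le ((re_inner_le_norm _ _).trans ?_)
  calc ‖x‖ * ‖Q.toCLM x‖ ≤ ‖x‖ * (‖Q.toCLM‖ * ‖x‖) := by
        gcongr; exact Q.toCLM.le_opNorm x
    _ = _ := by ring

lemma inducedCreation_apply_succ (ξ : E) (f : Fock φ π) (n : ℕ) :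
    inducedCreation φ π ξ f (n + 1) = creation φ (π.power φ n) ξ (f n) := rfl

/-- Creation sends a vector concentrated in degree `n` to one concentrated in degree `n + 1`;
pairing with such vectors reads off the adjoint. -/
lemma adjoint_inducedCreation_apply (ξ : E) (f : Fock φ π) (n : ℕ) :
    ContinuousLinearMap.adjoint (inducedCreation φ π ξ) f n =
      ContinuousLinearMap.adjoint (creation φ (π.power φ n) ξ) (f (n + 1)) := by
  classical
  let G : ℕ → Type u := fun n => (π.power φ n : Type u)
  refine ext_inner_left ℂ fun k => ?_
  have h : inducedCreation φ π ξ (lp.single (E := G) 2 n k) =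
      lp.single (E := G) 2 (n + 1) (creation φ (π.power φ n) ξ k) := by
    ext m
    cases m with
    | zero => exact (lp.single_apply_ne (E := G) 2 (n + 1) _ (Nat.succ_ne_zero n).symm).symm
    | succ m =>
      refine (inducedCreation_apply_succ φ ξ _ m).trans ?_
      by_cases hm : m = n
      · subst hm
        exact (congrArg (creation φ (π.power φ m) ξ) (lp.single_apply_self (E := G) 2 m k)).trans
          (lp.single_apply_self (E := G) 2 (m + 1) _).symm
      · refine (congrArg (creation φ (π.power φ m) ξ)
          (lp.single_apply_ne (E := G) 2 n k hm)).trans ((map_zero _).trans ?_)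
        exact (lp.single_apply_ne (E := G) 2 (n + 1) _ fun h => hm (Nat.succ.inj h)).symm
  refine (lp.inner_single_left (G := G) n k _).symm.trans ?_
  refine (ContinuousLinearMap.adjoint_inner_right _ _ _).trans ?_
  rw [h]
  refine (lp.inner_single_left (G := G) (n + 1) _ f).trans ?_
  exact (ContinuousLinearMap.adjoint_inner_right _ _ _).symm

/-- The adjoint form of (I ⊗ X*)(ξ ⊗ k) = ξ ⊗ X* k. -/
lemma adjoint_creation_tensor (X : Intertwiner σ τ) (ξ : E) (z : σ.tensor φ) :
    ContinuousLinearMap.adjoint (creation φ τ ξ) ((X.tensor φ).toCLM z) =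
      X.toCLM (ContinuousLinearMap.adjoint (creation φ σ ξ) z) := by
  refine ext_inner_left ℂ fun k => ?_
  rw [ContinuousLinearMap.adjoint_inner_right, ← ContinuousLinearMap.adjoint_inner_left,
    ← ContinuousLinearMap.adjoint_inner_left X.toCLM, ContinuousLinearMap.adjoint_inner_right]
  change ⟪(X.tensor φ).adj.toCLM _, _⟫_ℂ = ⟪creation φ σ ξ (X.adj.toCLM k), _⟫_ℂ
  rw [← Intertwiner.adj_tensor, tensor_toCLM_creation]

/-- Membership in `𝓘((S₀, σ₀), (η̂*, σ))` in terms of the adjoint. -/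
lemma mem_inducedIntertwiners_iff (C : Fock φ π →L[ℂ] σ) :
    C ∈ inducedIntertwiners φ π η ↔
      (∀ a x n, ContinuousLinearMap.adjoint C (σ.hom a x) n =
        (π.power φ n).hom a (ContinuousLinearMap.adjoint C x n)) ∧
      ∀ ξ x n, ContinuousLinearMap.adjoint (creation φ (π.power φ n) ξ)
          (ContinuousLinearMap.adjoint C x (n + 1)) =
        ContinuousLinearMap.adjoint C
          (ContinuousLinearMap.adjoint (creation φ σ ξ) (η.toCLM x)) n := by
  have hind : ∀ a, ContinuousLinearMap.adjoint (inducedHom φ π a) = inducedHom φ π (star a) := by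
    intro a
    refine ((ContinuousLinearMap.eq_adjoint_iff _ _).mpr fun f g => ?_).symm
    rw [lp.inner_eq_tsum, lp.inner_eq_tsum]
    refine tsum_congr fun n => ?_
    have := (π.power φ n).inner_hom_left (star a) (f n) (g n)
    rw [star_star] at this
    exact this
  refine and_congr ?_ ?_
  -- Adjoints turn `a` into `star a`, so the quantifier is first reindexed by the involution.
  · refine Iff.trans (star_involutive.surjective.forall) (forall_congr' fun a => ?_)
    rw [← ContinuousLinearMap.adjoint.injective.eq_iff, ContinuousLinearMap.adjoint_comp,
      ContinuousLinearMap.adjoint_comp, hind, HilbertRep.adjoint_hom, star_star]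
    constructor
    · intro h x n
      exact (congrArg (fun T : σ →L[ℂ] Fock φ π => T x n) h).symm
    · intro h
      ext x n
      exact (h x n).symm
  · refine forall_congr' fun ξ => ?_
    rw [← ContinuousLinearMap.adjoint.injective.eq_iff, ContinuousLinearMap.adjoint_comp,
      ContinuousLinearMap.adjoint_comp, covRep, ContinuousLinearMap.adjoint_comp,
      ContinuousLinearMap.adjoint_adjoint]
    constructor
    · intro h x n
      rw [← adjoint_inducedCreation_apply]
      exact congrArg (fun T : σ →L[ℂ] Fock φ π => T x n) h
    · intro h
      ext x n
      exact (adjoint_inducedCreation_apply φ ξ _ n).trans (h x n)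

/-- A complex operator is determined by its quadratic form, and positivity makes that of `Q` equal
to its real part. -/
lemma eq_comp_adjoint_of_norm_sq {H K : Type*} [NormedAddCommGroup H] [InnerProductSpace ℂ H]
    [CompleteSpace H] [NormedAddCommGroup K] [InnerProductSpace ℂ K] [CompleteSpace K]
    {Q : H →L[ℂ] H} (hQ : 0 ≤ Q) {B : H →L[ℂ] K} (h : ∀ x, ‖B x‖ ^ 2 = RCLike.re ⟪x, Q x⟫_ℂ) :
    Q = ContinuousLinearMap.adjoint B ∘L B := by
  have hpos := ContinuousLinearMap.nonneg_iff_isPositive Q |>.mp hQ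
  refine ContinuousLinearMap.coe_injective ((ext_inner_map _ _).mp fun x => ?_)
  change ⟪Q x, x⟫_ℂ = ⟪ContinuousLinearMap.adjoint B (B x), x⟫_ℂ
  rw [ContinuousLinearMap.adjoint_inner_left, inner_self_eq_norm_sq_to_K,
    hpos.inner_left_eq_inner_right]
  have h1 : ⟪x, Q x⟫_ℂ = ((RCLike.re ⟪x, Q x⟫_ℂ : ℝ) : ℂ) := by
    have := hpos.inner_nonneg_right x
    exact (Complex.eq_re_of_ofReal_le (r := 0) (by simpa using this))
  rw [h1, ← h]
  push_cast
  rfl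

/-- The adjoint of the Poisson kernel is an intertwiner `C` with `C C* = Q`. -/
lemma poissonKernel_adjoint_mem {c : Intertwiner σ π} {Q : Commutant σ}
    (hQ : IsPureSuperharmonic (cpMap φ η) Q)
    (hc : (c.adj.comp c).toCLM = Q.toCLM - (cpMap φ η Q).toCLM)
    {B : σ →L[ℂ] Fock φ π} (hB : ∀ x n, B x n = (poissonCoeff φ η c n).toCLM x) :
    ContinuousLinearMap.adjoint B ∈ inducedIntertwiners φ π η ∧
      Q.toCLM = ContinuousLinearMap.adjoint B ∘L
        ContinuousLinearMap.adjoint (ContinuousLinearMap.adjoint B) := by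
  rw [mem_inducedIntertwiners_iff, ContinuousLinearMap.adjoint_adjoint]
  refine ⟨⟨fun a x n => ?_, fun ξ x n => ?_⟩, eq_comp_adjoint_of_norm_sq hQ.nonneg fun x => ?_⟩
  · rw [hB, hB, Intertwiner.comm]
  · rw [hB, hB, poissonCoeff_succ]
    exact adjoint_creation_tensor φ _ ξ _
  · rw [lp_two_norm_sq, ← (hasSum_poissonCoeff φ η hQ hc x).tsum_eq]
    simp only [hB]

/-- Every intertwiner `C` is the adjoint of a Poisson kernel. -/
lemma exists_poissonCoeff_eq {C : Fock φ π →L[ℂ] σ} (hC : C ∈ inducedIntertwiners φ π η) :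
    ∃ c : Intertwiner σ π, ∀ x n,
      ContinuousLinearMap.adjoint C x n = (poissonCoeff φ η c n).toCLM x := by
  rw [mem_inducedIntertwiners_iff] at hC
  obtain ⟨h1, h2⟩ := hC
  -- The witness is the degree-zero coefficient of C*.
  refine ⟨⟨lp.evalCLM ℂ (fun n : ℕ => (π.power φ n : Type u)) 2 0 ∘L
    ContinuousLinearMap.adjoint C, fun a x => h1 a x 0⟩,
    fun x n => ?_⟩
  induction n generalizing x with
  | zero => rfl
  | succ n ih =>
    rw [poissonCoeff_succ]
    -- Annihilating by `ξ` lowers the degree: covariance reduces the claim at `x` to degree `n` at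
    -- the vector T_ξ* η x, hence the induction over all `x`.
    refine eq_of_adjoint_creation_eq φ fun ξ => ?_
    refine (h2 ξ x n).trans ((ih _).trans ?_)
    exact (adjoint_creation_tensor φ _ ξ _).symm

/-- If the adjoint of a Poisson kernel `C` has `C C* = Q`, then `Q` is pure superharmonic and the
zeroth coefficient is a square root of `Q - Φ(Q)`. -/
lemma defect_of_poissonKernel {C : Fock φ π →L[ℂ] σ} {c : Intertwiner σ π} {Q : Commutant σ}
    (hc : ∀ x n, ContinuousLinearMap.adjoint C x n = (poissonCoeff φ η c n).toCLM x)
    (hQ : Q.toCLM = C ∘L ContinuousLinearMap.adjoint C) :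
    (c.adj.comp c).toCLM = Q.toCLM - (cpMap φ η Q).toCLM ∧
      IsPureSuperharmonic (cpMap φ η) Q := by
  classical
  let q : ℕ → Commutant σ := fun n => (poissonCoeff φ η c n).adj.comp (poissonCoeff φ η c n)
  have hq : ∀ n, cpMap φ η (q n) = q (n + 1) := fun n => by
    simp only [q, adj_comp_poissonCoeff, Function.iterate_succ_apply']
  -- Expanding C* x into its homogeneous components and applying `C` gives Q = C C* as a strong sum
  -- of the `q n`.
  have hsum : ∀ x, HasSum (fun n => (q n).toCLM x) (Q.toCLM x) := fun x => by
    have h1 := (lp.hasSum_single (by norm_num) (ContinuousLinearMap.adjoint C x)).mapL C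
    have h2 : ∀ n, C (lp.single 2 n (ContinuousLinearMap.adjoint C x n)) = (q n).toCLM x := by
      intro n
      refine ext_inner_right ℂ fun y => ?_
      refine (ContinuousLinearMap.adjoint_inner_right _ _ _).symm.trans ?_
      refine (lp.inner_single_left n _ _).trans ?_
      rw [hc, hc]
      exact (ContinuousLinearMap.adjoint_inner_left _ _ _).symm
    simp only [h2] at h1
    rw [hQ]
    exact h1
  let S : ℕ → Commutant σ := fun N =>
    ⟨∑ n ∈ Finset.range N, (q n).toCLM, fun a x => by simp [Intertwiner.comm]⟩
  have hS : ∀ x, Tendsto (fun N => (S N).toCLM x) atTop (𝓝 (Q.toCLM x)) := fun x => by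
    simpa [S] using (hsum x).tendsto_sum_nat
  have hΦS : ∀ N, (cpMap φ η (S N)).toCLM = (S (N + 1)).toCLM - (c.adj.comp c).toCLM := by
    intro N
    induction N with
    | zero =>
      -- `S 0` is the zero operator, hence its own difference with itself; `cpMap_sub` then yields
      -- Φ(0) = 0.
      have h0 : (cpMap φ η (S 0)).toCLM = (cpMap φ η (S 0)).toCLM - (cpMap φ η (S 0)).toCLM :=
        cpMap_sub φ η (by simp [S])
      rw [h0, sub_self]
      simp only [S, zero_add, Finset.sum_range_one, q]
      exact (sub_self _).symm
    | succ N ih =>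
      have h1 := cpMap_sub φ η (X := q N) (Y := S (N + 1)) (Z := S N)
        (by simp [S, Finset.sum_range_succ])
      rw [hq, ih] at h1
      rw [show (S (N + 1 + 1)).toCLM = (S (N + 1)).toCLM + (q (N + 1)).toCLM from
        Finset.sum_range_succ _ _, h1]
      abel
  have hdef : (c.adj.comp c).toCLM = Q.toCLM - (cpMap φ η Q).toCLM := by
    ext x
    -- Φ(S_N) = S_{N+1} - c* c; the limit in N gives Φ(Q) = Q - c* c.
    have h1 := tendsto_cpMap φ η hS x
    simp only [hΦS] at h1
    have h2 := ((tendsto_add_atTop_iff_nat 1).mpr (hS x)).sub_const ((c.adj.comp c).toCLM x)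
    have h3 := tendsto_nhds_unique h1 h2
    simp [h3]
  refine ⟨hdef, ⟨?_, ?_⟩, fun x => ?_⟩
  · have h1 := ContinuousLinearMap.nonneg_iff_isPositive _ |>.mpr
      (ContinuousLinearMap.isPositive_adjoint_comp_self (ContinuousLinearMap.adjoint C))
    rw [ContinuousLinearMap.adjoint_adjoint] at h1
    rwa [hQ]
  · rw [← sub_nonneg, ← hdef, ContinuousLinearMap.nonneg_iff_isPositive]
    exact ContinuousLinearMap.isPositive_adjoint_comp_self c.toCLM
  -- Telescoping identifies Φ^N(Q) with the tail Q - S_N of a convergent series.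
  · have h1 : ∀ N, ((cpMap φ η)^[N] Q).toCLM x = Q.toCLM x - (S N).toCLM x := fun N => by
      have := sum_poissonCoeff φ η hdef N
      simp [S, q, this]
    simp only [h1]
    simpa using (hS x).const_sub (Q.toCLM x)

end Poisson

/-! ### Polar decomposition inside the category of representations. -/

section Polar

variable {M : Type w} [CStarAlgebra M] {σ τ ρ π : HilbertRep.{u} M}

/-- If `‖g v‖ ≤ ‖f v‖` for equivariant linear maps `f`, `g`, then `f v ↦ g v` extends to an
intertwiner that vanishes on the orthogonal complement of the range of `f`. -/
lemma exists_intertwiner_of_norm_le {V : Type*} [AddCommGroup V] [Module ℂ V]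
    (f : V →ₗ[ℂ] σ) (g : V →ₗ[ℂ] τ) (act : M → V → V)
    (hf : ∀ a v, f (act a v) = σ.hom a (f v)) (hg : ∀ a v, g (act a v) = τ.hom a (g v))
    (h : ∀ v, ‖g v‖ ≤ ‖f v‖) :
    ∃ A : Intertwiner σ τ, (∀ v, A.toCLM (f v) = g v) ∧
      (∀ z ∈ (LinearMap.range f)ᗮ, A.toCLM z = 0) ∧ ∀ z, ‖A.toCLM z‖ ≤ ‖z‖ := by
  let K : Submodule ℂ σ := (LinearMap.range f).topologicalClosure
  have hfK : ∀ v, f v ∈ K := fun v => (LinearMap.range f).le_topologicalClosure ⟨v, rfl⟩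
  have : CompleteSpace K := (LinearMap.range f).isClosed_topologicalClosure.completeSpace_coe
  let e : V →ₗ[ℂ] K := f.codRestrict K hfK
  have he : DenseRange e := by
    intro z
    rw [Metric.mem_closure_iff]
    intro ε hε
    have hz : (z : σ) ∈ closure (LinearMap.range f : Set σ) := z.2
    obtain ⟨_, ⟨v, rfl⟩, hv⟩ := Metric.mem_closure_iff.mp hz ε hε
    exact ⟨e v, ⟨v, rfl⟩, hv⟩
  have hn : ∀ v, ‖g v‖ ≤ 1 * ‖e v‖ := fun v => (h v).trans_eq (one_mul _).symm
  -- The norm inequality makes f v ↦ g v well defined and contractive, so it extends to the closure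
  -- `K`; the projection extends it by zero.
  let A : σ →L[ℂ] τ := g.extendOfNorm e ∘L K.orthogonalProjectionOnto
  have hA : ∀ v, A (f v) = g v := fun v => by
    have h1 : K.orthogonalProjectionOnto (f v) = e v :=
      K.orthogonalProjectionOnto_mem_subspace_eq_self (e v)
    simp only [A, ContinuousLinearMap.comp_apply, h1]
    exact LinearMap.extendOfNorm_eq he ⟨1, hn⟩ v
  have hA0 : ∀ z ∈ (LinearMap.range f)ᗮ, A z = 0 := fun z hz => by
    rw [← Submodule.orthogonal_closure] at hz
    have : K.orthogonalProjectionOnto z = 0 :=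
      Submodule.orthogonalProjectionOnto_apply_of_mem_orthogonal hz
    simp [A, this]
  refine ⟨⟨A, fun a x => ?_⟩, hA, hA0, fun z => ?_⟩
  · let D : σ →L[ℂ] τ := A ∘L σ.hom a - τ.hom a ∘L A
    have hD0 : ∀ z ∈ (LinearMap.range f)ᗮ, D z = 0 := fun z hz => by
      -- The complement is invariant because the range is invariant under every `star a`.
      have h1 : σ.hom a z ∈ (LinearMap.range f)ᗮ := by
        rintro _ ⟨v, rfl⟩
        have := σ.inner_hom_left (star a) (f v) z
        rw [star_star] at this
        rw [← this, ← hf]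
        exact hz _ ⟨_, rfl⟩
      simp [D, hA0 _ hz, hA0 _ h1]
    have hDf : ∀ z ∈ K, D z = 0 := by
      intro z hz
      have hcl : IsClosed {z | D z = 0} := isClosed_eq D.continuous continuous_const
      refine hcl.closure_subset_iff.mpr ?_ hz
      rintro _ ⟨v, rfl⟩
      simp [D, hA, ← hf, ← hg]
    have hx : D x = 0 := by
      obtain ⟨y, hy, z, hz, rfl⟩ := K.exists_add_mem_mem_orthogonal x
      rw [Submodule.orthogonal_closure] at hz
      rw [map_add, hDf y hy, hD0 z hz, add_zero]
    exact sub_eq_zero.mp hx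
  · have h1 := LinearMap.norm_extendOfNorm_apply_le (f := g) he 1 hn (K.orthogonalProjectionOnto z)
    rw [one_mul] at h1
    exact h1.trans (K.norm_orthogonalProjectionOnto_apply_le z)

/-- Polar decomposition: if `‖c x‖ = ‖r x‖` for all `x`, then `c = v r` for a partial isometry `v`
whose initial space is the closure of the range of `r`. -/
lemma exists_partialIsometry (c : Intertwiner σ τ) (r : Intertwiner σ ρ)
    (h : ∀ x, ‖c.toCLM x‖ = ‖r.toCLM x‖) :
    ∃ v : Intertwiner ρ τ, IsPartialIsometry v.toCLM ∧
      (LinearMap.range (r.toCLM : σ →ₗ[ℂ] ρ)).topologicalClosure ≤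
        (LinearMap.ker (v.toCLM : ρ →ₗ[ℂ] τ))ᗮ ∧ v.comp r = c := by
  obtain ⟨v, hv, hv0, -⟩ := exists_intertwiner_of_norm_le (r.toCLM : σ →ₗ[ℂ] ρ)
    (c.toCLM : σ →ₗ[ℂ] τ) (fun a x => σ.hom a x) r.comm c.comm fun x => (h x).le
  have hK : ∀ z ∈ (LinearMap.range (r.toCLM : σ →ₗ[ℂ] ρ)).topologicalClosure,
      ‖v.toCLM z‖ = ‖z‖ := by
    intro z hz
    have hcl : IsClosed {z | ‖v.toCLM z‖ = ‖z‖} :=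
      isClosed_eq v.toCLM.continuous.norm continuous_norm
    refine hcl.closure_subset_iff.mpr ?_ hz
    rintro _ ⟨x, rfl⟩
    change ‖v.toCLM ((r.toCLM : σ →ₗ[ℂ] ρ) x)‖ = _
    rw [hv]
    exact h x
  have : CompleteSpace (LinearMap.range (r.toCLM : σ →ₗ[ℂ] ρ)).topologicalClosure :=
    (Submodule.isClosed_topologicalClosure _).completeSpace_coe
  refine ⟨v, fun z hz => hK z ?_, ?_, Intertwiner.ext_toCLM (by ext x; exact hv x)⟩
  -- Since `v` kills the complement of the range, (ker v)ᗮ lies in the closed range, where `v` is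
  -- isometric.
  · rw [← Submodule.orthogonal_orthogonal_eq_closure]
    exact Submodule.orthogonal_le (fun y hy => hv0 y hy) hz
  · intro y hy z hz
    obtain ⟨y', hy', z', hz', rfl⟩ := Submodule.exists_add_mem_mem_orthogonal
      (K := (LinearMap.range (r.toCLM : σ →ₗ[ℂ] ρ)).topologicalClosure) z
    rw [Submodule.orthogonal_closure] at hz'
    have h0 : v.toCLM y' = 0 := by
      have : v.toCLM (y' + z') = 0 := hz
      rwa [map_add, hv0 z' hz', add_zero] at this
    have h1 : y' = 0 := by
      rw [← norm_eq_zero, ← hK y' hy', h0, norm_zero]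
    rw [h1, zero_add]
    rw [← Submodule.orthogonal_closure] at hz'
    exact Submodule.inner_left_of_mem_orthogonal hy hz'

lemma adjoint_sqrt_comp_sqrt {H : Type*} [NormedAddCommGroup H] [InnerProductSpace ℂ H]
    [CompleteSpace H] {T : H →L[ℂ] H} (hT : 0 ≤ T) :
    ContinuousLinearMap.adjoint (CFC.sqrt T) = CFC.sqrt T ∧
      ContinuousLinearMap.adjoint (CFC.sqrt T) ∘L CFC.sqrt T = T := by
  have h1 : ContinuousLinearMap.adjoint (CFC.sqrt T) = CFC.sqrt T :=
    (CFC.sqrt_nonneg T).isSelfAdjoint.star_eq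
  exact ⟨h1, by rw [h1]; exact CFC.sqrt_mul_sqrt_self T hT⟩

lemma norm_eq_of_adj_comp_eq {c : Intertwiner σ τ} {r : Intertwiner σ ρ}
    (h : (c.adj.comp c).toCLM = (r.adj.comp r).toCLM) (x : σ) : ‖c.toCLM x‖ = ‖r.toCLM x‖ := by
  have h1 := inner_adj_comp_self c x
  rw [h, inner_adj_comp_self] at h1
  have h2 : ‖r.toCLM x‖ ^ 2 = ‖c.toCLM x‖ ^ 2 := Complex.ofReal_injective h1
  exact ((sq_eq_sq₀ (norm_nonneg _) (norm_nonneg _)).mp h2).symm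

/-- An injective intertwiner yields an isometric one. -/
lemma exists_isometry_of_injective (c : Intertwiner σ τ) (hc : Function.Injective c.toCLM) :
    ∃ v : Intertwiner σ τ, ∀ x, ‖v.toCLM x‖ = ‖x‖ := by
  have hQ : 0 ≤ (c.adj.comp c).toCLM := (ContinuousLinearMap.nonneg_iff_isPositive _).mpr
    (ContinuousLinearMap.isPositive_adjoint_comp_self c.toCLM)
  let r : Commutant σ := ⟨CFC.sqrt (c.adj.comp c).toCLM, fun a x => by
    have h : Commute (c.adj.comp c).toCLM (σ.hom a) := by
      ext x; exact (c.adj.comp c).comm a x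
    exact congrArg (fun T : σ →L[ℂ] σ => T x) (h.cfcₙ_nnreal NNReal.sqrt).eq⟩
  have hr := adjoint_sqrt_comp_sqrt hQ
  have hn : ∀ x, ‖c.toCLM x‖ = ‖r.toCLM x‖ := norm_eq_of_adj_comp_eq hr.2.symm
  obtain ⟨v, hv, hle, -⟩ := exists_partialIsometry c r hn
  refine ⟨v, fun x => hv x (hle ?_)⟩
  -- `r` = |c| is self-adjoint and injective along with `c`, so its range is dense and the initial
  -- space of `v` is everything.
  have h0 : (LinearMap.range (r.toCLM : σ →ₗ[ℂ] σ))ᗮ = ⊥ := by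
    rw [Submodule.eq_bot_iff]
    intro y hy
    have h1 : r.toCLM y = 0 := by
      rw [← inner_self_eq_zero (𝕜 := ℂ), ← ContinuousLinearMap.adjoint_inner_left, show ContinuousLinearMap.adjoint r.toCLM = r.toCLM
          from hr.1]
      exact hy _ ⟨_, rfl⟩
    refine hc ?_
    rw [map_zero, ← norm_eq_zero, hn, h1, norm_zero]
  rw [← Submodule.orthogonal_orthogonal_eq_closure, h0, Submodule.bot_orthogonal_eq_top]
  trivial

lemma sqrtDefect_adj_comp_self {Φ : Commutant σ → Commutant σ} {Q : Commutant σ}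
    (hQ : IsSuperharmonic Φ Q) :
    ((sqrtDefect Φ Q).adj.comp (sqrtDefect Φ Q)).toCLM = Q.toCLM - (Φ Q).toCLM :=
  (adjoint_sqrt_comp_sqrt (sub_nonneg.mpr hQ.map_le)).2

/-- A partial isometry preserves norms on its initial space, hence `(v r)* (v r) = r* r` when the
range of `r` lies there. -/
lemma comp_adj_comp_self {v : Intertwiner τ π} {r : Intertwiner σ τ}
    (hv : IsPartialIsometry v.toCLM)
    (hr : (LinearMap.range (r.toCLM : σ →ₗ[ℂ] τ)).topologicalClosure ≤
      (LinearMap.ker (v.toCLM : τ →ₗ[ℂ] π))ᗮ) :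
    ((v.comp r).adj.comp (v.comp r)).toCLM = (r.adj.comp r).toCLM := by
  refine ContinuousLinearMap.coe_injective ((ext_inner_map _ _).mp fun x => ?_)
  rw [← inner_conj_symm, ← inner_conj_symm (((r.adj.comp r).toCLM : σ →ₗ[ℂ] σ) x)]
  refine congrArg _ ((inner_adj_comp_self (v.comp r) x).trans ?_)
  refine Eq.trans ?_ (inner_adj_comp_self r x).symm
  have : ‖(v.comp r).toCLM x‖ = ‖r.toCLM x‖ :=
    hv _ (hr (Submodule.le_topologicalClosure _ ⟨x, rfl⟩))
  rw [this]

end Polar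

/-! ### Representations of infinite multiplicity and isometric embedding into them. -/

section Absorbing

variable {M : Type w} [CStarAlgebra M] {X : Type v} [NormedAddCommGroup X] [NormedSpace ℂ X]
  (p : M ≃ₗᵢ[ℂ] StrongDual ℂ X) {σ π : HilbertRep.{u} M}

/-- The infinite ampliation of `π` embeds in `π`. -/
def HilbertRep.IsAbsorbing (π : HilbertRep.{u} M) : Prop :=
  ∃ U : lp (fun _ : ℕ => (π : Type u)) 2 →ₗᵢ[ℂ] π,
    ∀ (a : M) (f g : lp (fun _ : ℕ => (π : Type u)) 2),
      (∀ n, g n = π.hom a (f n)) → U g = π.hom a (U f)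

lemma lp_two_summable {ι : Type*} {G : ι → Type*} [∀ i, NormedAddCommGroup (G i)] (f : lp G 2) :
    Summable fun n => ‖f n‖ ^ 2 := by
  simpa using (lp.memℓp f).summable (by norm_num)

/-- An infinite ampliation of an infinite ampliation of `ρ` is indexed by ℕ × ℕ, and `Nat.unpair`
reindexes it by ℕ. -/
lemma HilbertRep.IsInfiniteAmpliation.isAbsorbing (hπ : π.IsInfiniteAmpliation p) :
    π.IsAbsorbing := by
  obtain ⟨ρ, -, -, W, hW⟩ := hπ
  let G : ℕ → Type u := fun _ => (ρ : Type u)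
  have hs : ∀ f : lp (fun _ : ℕ => (π : Type u)) 2,
      HasSum (fun j : ℕ => ‖(W (f (Nat.unpair j).1) : ∀ n, G n) (Nat.unpair j).2‖ ^ 2)
        (‖f‖ ^ 2) := by
    intro f
    have h1 : ∀ n, HasSum (fun m => ‖(W (f n) : ∀ n, G n) m‖ ^ 2) (‖f n‖ ^ 2) := fun n => by
      rw [← W.norm_map (f n), lp_two_norm_sq]
      exact (lp_two_summable (W (f n))).hasSum
    have h2 : Summable fun q : ℕ × ℕ => ‖(W (f q.1) : ∀ n, G n) q.2‖ ^ 2 := by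
      rw [summable_prod_of_nonneg fun q => sq_nonneg _]
      exact ⟨fun n => (h1 n).summable, by simpa only [(h1 _).tsum_eq] using lp_two_summable f⟩
    have h3 : HasSum (fun q : ℕ × ℕ => ‖(W (f q.1) : ∀ n, G n) q.2‖ ^ 2) (‖f‖ ^ 2) := by
      rw [lp_two_norm_sq]
      have h4 := h2.hasSum.prod_fiberwise h1
      rw [h4.tsum_eq]
      exact h2.hasSum
    exact (Nat.pairEquiv.symm.hasSum_iff (f := fun q : ℕ × ℕ =>
      ‖(W (f q.1) : ∀ n, G n) q.2‖ ^ 2)).mpr h3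
  let F : lp (fun _ : ℕ => (π : Type u)) 2 →ₗ[ℂ] lp G 2 :=
    { toFun := fun f => ⟨fun j => (W (f (Nat.unpair j).1) : ∀ n, G n) (Nat.unpair j).2,
        memℓp_gen (by simpa using (hs f).summable)⟩
      map_add' := fun f g => by ext j; simp; rfl
      map_smul' := fun c f => by ext j; simp }
  have hF : ∀ f, ‖F f‖ = ‖f‖ := fun f => by
    refine (sq_eq_sq₀ (norm_nonneg _) (norm_nonneg _)).mp ?_
    rw [lp_two_norm_sq]
    exact (hs f).tsum_eq
  refine ⟨W.symm.toLinearIsometry.comp ⟨F, hF⟩, fun a f g h => ?_⟩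
  refine W.injective ?_
  ext j
  rw [hW]
  change W (W.symm (F g)) j = ρ.hom a (W (W.symm (F f)) j)
  rw [W.apply_symm_apply, W.apply_symm_apply]
  change (W (g (Nat.unpair j).1) : ∀ n, G n) (Nat.unpair j).2 =
    ρ.hom a ((W (f (Nat.unpair j).1) : ∀ n, G n) (Nat.unpair j).2)
  rw [h, hW]

/-- The matrix coefficients of `π` are normal functionals. -/
def HilbertRep.HasNormalCoeff (π : HilbertRep.{u} M) : Prop :=
  ∀ h k : π, ∃ x : X, ∀ a, p a x = ⟪h, π.hom a k⟫_ℂ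

lemma HilbertRep.IsNormal.hasNormalCoeff (hσ : σ.IsNormal p) : σ.HasNormalCoeff p := by
  classical
  intro h k
  obtain ⟨x, hx⟩ := hσ (lp.single 2 0 h) (lp.single 2 0 k)
  refine ⟨x, fun a => ?_⟩
  refine (hx a).symm.trans ((tsum_eq_single 0 fun n hn => ?_).trans ?_)
  · simp [hn]
  · simp

/-- A coefficient of the ampliation is a square-summable series of coefficients of `ρ`, the very
form of functional in `IsNormal`. -/
lemma HilbertRep.IsInfiniteAmpliation.hasNormalCoeff (hπ : π.IsInfiniteAmpliation p) :
    π.HasNormalCoeff p := by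
  obtain ⟨ρ, hρ, -, W, hW⟩ := hπ
  intro h k
  obtain ⟨x, hx⟩ := hρ (W h) (W k)
  refine ⟨x, fun a => ?_⟩
  rw [← hx, ← W.inner_map_map, lp.inner_eq_tsum]
  simp only [hW]

lemma HilbertRep.IsInfiniteAmpliation.injective (hπ : π.IsInfiniteAmpliation p) :
    Function.Injective π.hom := by
  classical
  obtain ⟨ρ, -, hρ, W, hW⟩ := hπ
  intro a b hab
  refine hρ ?_
  ext y
  have h1 := hW a (W.symm (lp.single 2 0 y)) 0
  have h2 := hW b (W.symm (lp.single 2 0 y)) 0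
  rw [hab, h2] at h1
  simpa using h1.symm

/-- Infinite multiplicity collapses a series of matrix coefficients into one. -/
lemma HilbertRep.IsAbsorbing.exists_sum (hπ : π.IsAbsorbing)
    (f g : lp (fun _ : ℕ => (π : Type u)) 2) :
    ∃ h k : π, ∀ a, HasSum (fun n => ⟪f n, π.hom a (g n)⟫_ℂ) ⟪h, π.hom a k⟫_ℂ := by
  obtain ⟨U, hU⟩ := hπ
  refine ⟨U f, U g, fun a => ?_⟩
  let g' : lp (fun _ : ℕ => (π : Type u)) 2 :=
    lp.mapCLM 2 (fun _ : ℕ => π.hom a) (norm_nonneg a)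
      (fun _ => NonUnitalStarAlgHom.norm_apply_le π.hom a) g
  rw [← hU a g g' fun n => rfl, U.inner_map_map]
  exact lp.hasSum_inner f g'

/-- `P h h'` is the copy in π of h ⊕ h'; the same `P` serves both slots of the inner product, so it
also computes norms. -/
lemma HilbertRep.IsAbsorbing.exists_pair (hπ : π.IsAbsorbing) :
    ∃ P : π → π → π, ∀ a h h' k k',
      ⟪P h h', π.hom a (P k k')⟫_ℂ = ⟪h, π.hom a k⟫_ℂ + ⟪h', π.hom a k'⟫_ℂ := by
  classical
  obtain ⟨U, hU⟩ := hπ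
  refine ⟨fun h h' => U (lp.single 2 0 h + lp.single 2 1 h'), fun a h h' k k' => ?_⟩
  rw [← hU a _ (lp.single 2 0 (π.hom a k) + lp.single 2 1 (π.hom a k')), U.inner_map_map,
    inner_add_left, lp.inner_single_left, lp.inner_single_left]
  · simp
  · intro n
    by_cases h0 : n = 0
    · subst h0; simp
    · by_cases h1 : n = 1
      · subst h1; simp
      · simp [h0, h1]

variable {p}

/-- The functionals `⟨h, π(·) k⟩` with `‖h‖, ‖k‖ ≤ 1` are dense in the unit ball of the predual. -/
lemma mem_closure_coeff (hπ : π.IsAbsorbing) (hn : π.HasNormalCoeff p)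
    (hi : Function.Injective π.hom) {x : X} (hx : ‖x‖ ≤ 1) :
    x ∈ closure {y : X | ∃ h k : π, ‖h‖ ≤ 1 ∧ ‖k‖ ≤ 1 ∧ ∀ a, p a y = ⟪h, π.hom a k⟫_ℂ} := by
  set D := {y : X | ∃ h k : π, ‖h‖ ≤ 1 ∧ ‖k‖ ≤ 1 ∧ ∀ a, p a y = ⟪h, π.hom a k⟫_ℂ} with hD
  obtain ⟨P, hP⟩ := hπ.exists_pair
  have hPn : ∀ s t : ℝ, 0 ≤ s → 0 ≤ t → s + t = 1 → ∀ h h' : π, ‖h‖ ≤ 1 → ‖h'‖ ≤ 1 →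
      ‖P ((Real.sqrt s : ℂ) • h) ((Real.sqrt t : ℂ) • h')‖ ≤ 1 := by
    intro s t hs ht hst h h' hh hh'
    have h1 := hP 1 ((Real.sqrt s : ℂ) • h) ((Real.sqrt t : ℂ) • h') ((Real.sqrt s : ℂ) • h)
      ((Real.sqrt t : ℂ) • h')
    simp only [map_one, one_apply_eq_self] at h1
    have h2 := congrArg RCLike.re h1
    rw [map_add, inner_self_eq_norm_sq, inner_self_eq_norm_sq, inner_self_eq_norm_sq, norm_smul,
      norm_smul, mul_pow, mul_pow] at h2
    simp only [Complex.norm_real, Real.norm_eq_abs, sq_abs, Real.sq_sqrt hs, Real.sq_sqrt ht] at h2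
    refine (sq_le_one_iff₀ (norm_nonneg _)).mp ?_
    rw [h2]
    have := pow_le_one₀ (n := 2) (norm_nonneg h) hh
    have := pow_le_one₀ (n := 2) (norm_nonneg h') hh'
    nlinarith
  -- The weights √s, √t in both vectors produce s and t in the coefficient and keep the norms at
  -- most 1.
  have hconv : Convex ℝ D := by
    rintro y ⟨h, k, hh, hk, hy⟩ y' ⟨h', k', hh', hk', hy'⟩ s t hs ht hst
    refine ⟨_, _, hPn s t hs ht hst h h' hh hh', hPn s t hs ht hst k k' hk hk', fun a => ?_⟩
    have e : ∀ s : ℝ, 0 ≤ s → (Real.sqrt s : ℂ) * (Real.sqrt s : ℂ) = s := fun s hs => by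
      rw [← Complex.ofReal_mul, Real.mul_self_sqrt hs]
    rw [hP, map_add, ← Complex.coe_smul, ← Complex.coe_smul, map_smul, map_smul, hy, hy']
    simp only [map_smul, inner_smul_left, inner_smul_right, Complex.conj_ofReal, ← mul_assoc,
      e s hs, e t ht, smul_eq_mul]
  by_contra hcon
  -- A functional on the predual is an element `a` of `M`. Separation would give ‖a‖ = ‖π(a)‖ ≤ u <
  -- Re a(x) ≤ ‖a‖, where faithfulness of π makes it isometric.
  obtain ⟨f, u, hu, hux⟩ := RCLike.geometric_hahn_banach_closed_point (𝕜 := ℂ) hconv.closure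
    isClosed_closure hcon
  obtain ⟨a, rfl⟩ := p.surjective f
  have hre : ∀ h k : π, ‖h‖ ≤ 1 → ‖k‖ ≤ 1 → RCLike.re ⟪h, π.hom a k⟫_ℂ ≤ u := by
    intro h k hh hk
    obtain ⟨y, hy⟩ := hn h k
    rw [← hy]
    exact (hu y (subset_closure ⟨h, k, hh, hk, hy⟩)).le
  have hu0 : 0 ≤ u := by simpa using hre 0 0 (by simp) (by simp)
  have hna : ‖a‖ ≤ u := by
    rw [← NonUnitalStarAlgHom.norm_map π.hom hi a]
    refine ContinuousLinearMap.opNorm_le_of_unit_norm hu0 fun k hk => ?_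
    by_cases h0 : π.hom a k = 0
    · rwa [h0, norm_zero]
    -- Pairing with the normalized vector π(a) k recovers ‖π(a) k‖.
    have h1 := hre (((‖π.hom a k‖⁻¹ : ℝ) : ℂ) • π.hom a k) k
      (by rw [norm_smul]; simp [h0]) hk.le
    rw [inner_smul_left, inner_self_eq_norm_sq_to_K, Complex.conj_ofReal] at h1
    have h2 : ((‖π.hom a k‖⁻¹ : ℝ) : ℂ) * ((‖π.hom a k‖ : ℝ) : ℂ) ^ 2 = ((‖π.hom a k‖ : ℝ) : ℂ) := by
      norm_cast
      field_simp
    have h3 : RCLike.re (((‖π.hom a k‖⁻¹ : ℝ) : ℂ) * ((‖π.hom a k‖ : ℝ) : ℂ) ^ 2) ≤ u := h1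
    rw [h2] at h3
    simpa using h3
  have h1 : RCLike.re (p a x) ≤ ‖a‖ * 1 := by
    refine (RCLike.re_le_norm _).trans (((p a).le_opNorm x).trans ?_)
    rw [p.norm_map]
    gcongr
  linarith

/-- Density in the unit ball, rescaled with √‖x‖ in each vector. Halving the error and bounding the
squared norms by ‖x‖ is what makes the iteration below square summable. -/
lemma exists_coeff_approx (hπ : π.IsAbsorbing) (hn : π.HasNormalCoeff p)
    (hi : Function.Injective π.hom) (x : X) :
    ∃ (y : X) (h k : π), ‖h‖ ^ 2 ≤ ‖x‖ ∧ ‖k‖ ^ 2 ≤ ‖x‖ ∧ ‖x - y‖ ≤ ‖x‖ / 2 ∧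
      ∀ a, p a y = ⟪h, π.hom a k⟫_ℂ := by
  by_cases hx : x = 0
  · exact ⟨0, 0, 0, by simp [hx]⟩
  have hx0 : 0 < ‖x‖ := norm_pos_iff.mpr hx
  have h1 := mem_closure_coeff hπ hn hi (x := ((‖x‖⁻¹ : ℝ) : ℂ) • x) (by
    rw [norm_smul]; simp [hx])
  obtain ⟨y, ⟨h, k, hh, hk, hy⟩, hd⟩ := Metric.mem_closure_iff.mp h1 (1 / 2) (by norm_num)
  have hb : ∀ z : π, ‖z‖ ≤ 1 → ‖((Real.sqrt ‖x‖ : ℝ) : ℂ) • z‖ ^ 2 ≤ ‖x‖ := fun z hz => by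
    rw [norm_smul, mul_pow, Complex.norm_real, Real.norm_eq_abs, sq_abs, Real.sq_sqrt hx0.le]
    exact mul_le_of_le_one_right hx0.le (pow_le_one₀ (norm_nonneg _) hz)
  refine ⟨(‖x‖ : ℂ) • y, _, _, hb h hh, hb k hk, ?_, fun a => ?_⟩
  · have h2 : x - (‖x‖ : ℂ) • y = (‖x‖ : ℂ) • (((‖x‖⁻¹ : ℝ) : ℂ) • x - y) := by
      rw [smul_sub, smul_smul, ← Complex.ofReal_mul, mul_inv_cancel₀ hx0.ne', Complex.ofReal_one,
        one_smul]
    rw [dist_eq_norm] at hd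
    rw [h2, norm_smul, Complex.norm_real, norm_norm]
    nlinarith
  · rw [map_smul, hy, map_smul, inner_smul_left, inner_smul_right, Complex.conj_ofReal, ← mul_assoc,
      ← Complex.ofReal_mul, Real.mul_self_sqrt hx0.le, smul_eq_mul]

/-- Every normal functional is a matrix coefficient of an absorbing faithful normal
representation. -/
lemma exists_coeff (hπ : π.IsAbsorbing) (hn : π.HasNormalCoeff p)
    (hi : Function.Injective π.hom) (x : X) : ∃ h k : π, ∀ a, p a x = ⟪h, π.hom a k⟫_ℂ := by
  choose Y h k hh hk hY hp using exists_coeff_approx hπ hn hi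
  -- Successive remainders after subtracting the approximating coefficient; their norms decay like
  -- 2⁻ⁿ.
  let xs : ℕ → X := fun n => (fun x => x - Y x)^[n] x
  have hxs : ∀ n, xs (n + 1) = xs n - Y (xs n) := fun n => Function.iterate_succ_apply' _ _ _
  have hnorm : ∀ n, ‖xs n‖ ≤ ‖x‖ * (1 / 2) ^ n := by
    intro n
    induction n with
    | zero => simp [xs]
    | succ n ih => rw [hxs, pow_succ]; linarith [hY (xs n)]
  have hgeo : Summable fun n : ℕ => ‖x‖ * (1 / 2 : ℝ) ^ n :=
    (summable_geometric_of_lt_one (by norm_num) (by norm_num)).mul_left _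
  have hmem : ∀ z : X → π, (∀ x, ‖z x‖ ^ 2 ≤ ‖x‖) →
      Memℓp (fun n : ℕ => z (xs n)) 2 := fun z hz => memℓp_gen (by
    simpa using Summable.of_nonneg_of_le (fun n => sq_nonneg _)
      (fun n => (hz (xs n)).trans (hnorm n)) hgeo)
  obtain ⟨h', k', hs⟩ := hπ.exists_sum ⟨fun n => h (xs n), hmem h hh⟩ ⟨fun n => k (xs n), hmem k hk⟩
  refine ⟨h', k', fun a => ?_⟩
  have h1 := (hs a).tendsto_sum_nat
  have h2 : ∀ N, ∑ n ∈ Finset.range N, ⟪h (xs n), π.hom a (k (xs n))⟫_ℂ = p a (x - xs N) := by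
    intro N
    induction N with
    | zero => simp [xs]
    | succ N ih =>
      rw [Finset.sum_range_succ, ih, ← hp, ← map_add, hxs]
      congr 1
      abel
  have h3 : Tendsto (fun N => p a (x - xs N)) atTop (𝓝 (p a (x - 0))) :=
    ((p a).continuous.tendsto _).comp (tendsto_const_nhds.sub
      (squeeze_zero_norm hnorm hgeo.tendsto_atTop_zero))
  rw [sub_zero] at h3
  exact tendsto_nhds_unique h3 (h1.congr h2)

/-- Every vector of a normal representation lies in the range of a contractive intertwiner from
an absorbing faithful normal representation. -/
lemma exists_intertwiner_apply_eq (hπ : π.IsAbsorbing) (hn : π.HasNormalCoeff p)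
    (hi : Function.Injective π.hom) (hσ : σ.HasNormalCoeff p) (y : σ) :
    ∃ (A : Intertwiner π σ) (g : π), (∀ z, ‖A.toCLM z‖ ≤ ‖z‖) ∧ A.toCLM g = y := by
  obtain ⟨x, hx⟩ := hσ y y
  obtain ⟨h, k, hhk⟩ := exists_coeff hπ hn hi x
  obtain ⟨P, hP⟩ := hπ.exists_pair
  -- With g = h ⊕ k, ‖π(a) g‖² = ‖π(a) h‖² + ‖π(a) k‖² ≥ Re ⟨π(a) h, π(a) k⟩ = ‖σ(a) y‖², so π(a) g
  -- ↦ σ(a) y is contractive.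
  let g := P h k
  have key : ∀ (τ : HilbertRep.{u} M) (a : M) (z z' : τ),
      ⟪z, τ.hom (star a * a) z'⟫_ℂ = ⟪τ.hom a z, τ.hom a z'⟫_ℂ := fun τ a z z' => by
    rw [map_mul, τ.inner_hom_left a]
    rfl
  have hg : ∀ a, ‖σ.hom a y‖ ≤ ‖π.hom a g‖ := by
    intro a
    refine (sq_le_sq₀ (norm_nonneg _) (norm_nonneg _)).mp ?_
    have h1 := hx (star a * a)
    rw [hhk, key, key] at h1
    have h2 := hP (star a * a) h k h k
    rw [key, key, key] at h2
    have h3 := congrArg RCLike.re h1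
    have h4 := congrArg RCLike.re h2
    rw [inner_self_eq_norm_sq] at h3
    rw [map_add, inner_self_eq_norm_sq, inner_self_eq_norm_sq, inner_self_eq_norm_sq] at h4
    have h5 := re_inner_le_norm (𝕜 := ℂ) (π.hom a h) (π.hom a k)
    change _ ≤ ‖π.hom a (P h k)‖ ^ 2
    nlinarith [sq_nonneg (‖π.hom a h‖ - ‖π.hom a k‖), sq_nonneg ‖π.hom a h‖, sq_nonneg ‖π.hom a k‖]
  let ev : ∀ (τ : HilbertRep.{u} M), τ → M →ₗ[ℂ] τ := fun τ z =>
    { toFun := fun a => τ.hom a z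
      map_add' := fun a b => by simp
      map_smul' := fun c a => by simp }
  obtain ⟨A, hA, -, hA1⟩ := exists_intertwiner_of_norm_le (ev π g) (ev σ y) (fun a b => a * b)
    (fun a b => by simp [ev]) (fun a b => by simp [ev]) hg
  refine ⟨A, g, hA1, ?_⟩
  simpa [ev] using hA 1

/-- A normal representation on a separable space embeds isometrically into an absorbing faithful
normal representation. -/
lemma exists_isometric_intertwiner [TopologicalSpace.SeparableSpace σ] (hπ : π.IsAbsorbing)
    (hn : π.HasNormalCoeff p) (hi : Function.Injective π.hom) (hσ : σ.HasNormalCoeff p) :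
    ∃ v : Intertwiner σ π, ∀ x, ‖v.toCLM x‖ = ‖x‖ := by
  choose A g hA hAg using exists_intertwiner_apply_eq hπ hn hi hσ
  let d : ℕ → σ := TopologicalSpace.denseSeq σ
  obtain ⟨U, hU⟩ := hπ
  -- Since `A (d n)` maps `g (d n)` to `d n`, ⟨d n, y⟩ = ⟨g (d n), T n y⟩: a vector killed by all `T
  -- n` is orthogonal to a dense set.
  let T : ℕ → Intertwiner σ π := fun n => (A (d n)).adj
  have hT : ∀ n y, ‖(T n).toCLM y‖ ≤ ‖y‖ := fun n y => by
    refine ContinuousLinearMap.le_of_opNorm_le _ (c := 1) ?_ y |>.trans_eq (one_mul _)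
    refine (LinearIsometryEquiv.norm_map ContinuousLinearMap.adjoint (A (d n)).toCLM).trans_le ?_
    exact ContinuousLinearMap.opNorm_le_bound _ zero_le_one fun z => by simpa using hA (d n) z
  have hle : ∀ y n, ‖((1 / 2 : ℂ) ^ n) • (T n).toCLM y‖ ^ 2 ≤ (1 / 4) ^ n * ‖y‖ ^ 2 := by
    intro y n
    rw [norm_smul, mul_pow, norm_pow, ← pow_mul, mul_comm n 2, pow_mul]
    have : ‖(1 / 2 : ℂ)‖ ^ 2 = 1 / 4 := by norm_num
    rw [this]
    gcongr
    exact hT n y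
  have hgeo : HasSum (fun n : ℕ => (1 / 4 : ℝ) ^ n) (4 / 3) := by
    convert! hasSum_geometric_of_lt_one (r := (1 / 4 : ℝ)) (by norm_num) (by norm_num) using 1
    norm_num
  have hs : ∀ y, Summable fun n => ‖((1 / 2 : ℂ) ^ n) • (T n).toCLM y‖ ^ 2 := fun y =>
    Summable.of_nonneg_of_le (fun n => sq_nonneg _) (hle y) (hgeo.summable.mul_right _)
  -- The weights 2⁻ⁿ ensure square summability; the squares sum to 4/3 ≤ 2², whence the bound 2.
  let S : σ →L[ℂ] lp (fun _ : ℕ => (π : Type u)) 2 := LinearMap.mkContinuous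
    { toFun := fun y => ⟨fun n => ((1 / 2 : ℂ) ^ n) • (T n).toCLM y, memℓp_gen (by
        simpa only [ENNReal.toReal_ofNat, Real.rpow_ofNat] using hs y)⟩
      map_add' := fun y z => by ext n; simp; rfl
      map_smul' := fun c y => by ext n; simp [smul_comm c] } 2 fun y => by
    refine (sq_le_sq₀ (norm_nonneg _) (by positivity)).mp ?_
    rw [lp_two_norm_sq]
    refine ((hs y).tsum_le_tsum (hle y) (hgeo.summable.mul_right _)).trans ?_
    rw [tsum_mul_right, hgeo.tsum_eq, mul_pow]
    gcongr
    norm_num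
  have hS : ∀ y n, S y n = ((1 / 2 : ℂ) ^ n) • (T n).toCLM y := fun y n => rfl
  refine exists_isometry_of_injective ⟨U.toContinuousLinearMap ∘L S, fun a y => ?_⟩ ?_
  · exact hU a (S y) (S (σ.hom a y)) fun n => by rw [hS, hS, (T n).comm, map_smul]
  · refine (injective_iff_map_eq_zero _).mpr fun y hy => ?_
    have h0 : S y = 0 := U.injective (by rw [map_zero]; exact hy)
    have h1 : ∀ n, (T n).toCLM y = 0 := fun n => by
      have := hS y n
      rw [h0] at this
      simpa using this.symm
    have h2 : ∀ n, ⟪d n, y⟫_ℂ = 0 := fun n => by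
      rw [← hAg (d n), ← ContinuousLinearMap.adjoint_inner_right]
      exact (congrArg (fun z => ⟪g (d n), z⟫_ℂ) (h1 n)).trans (inner_zero_right _)
    have h3 : ∀ z, ⟪z, y⟫_ℂ = 0 := fun z => by
      have hcl : IsClosed {z | ⟪z, y⟫_ℂ = 0} := isClosed_eq (by fun_prop) continuous_const
      refine hcl.closure_subset_iff.mpr ?_ (TopologicalSpace.denseRange_denseSeq σ z)
      rintro _ ⟨n, rfl⟩
      exact h2 n
    exact inner_self_eq_zero.mp (h3 y)

end Absorbing

/-! ### Intertwiners from partial isometries, and the theorem. -/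

section FromPartialIsometry

variable {M : Type w} [CStarAlgebra M] [PartialOrder M] [StarOrderedRing M]
  {E : Type u} [NormedAddCommGroup E] [NormedSpace ℂ E] [Module Mᵐᵒᵖ E] [HilbertModule M E]
  (φ : LeftAction M E) {σ τ π : HilbertRep.{u} M} (η : SigmaDual φ σ)

/-- The Poisson kernel `C` of `Q` built from a partial isometry `v`. -/
lemma exists_intertwiner_of_partialIsometry {Q : Commutant σ}
    (hQ : IsPureSuperharmonic (cpMap φ η) Q) {r : Intertwiner σ τ}
    (hr : (r.adj.comp r).toCLM = Q.toCLM - (cpMap φ η Q).toCLM) {B : σ →L[ℂ] Fock φ τ}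
    (hB : ∀ x n, B x n = (poissonCoeff φ η r n).toCLM x) {v : Intertwiner τ π}
    (hv : IsPartialIsometry v.toCLM)
    (hvr : (LinearMap.range (r.toCLM : σ →ₗ[ℂ] τ)).topologicalClosure ≤
      (LinearMap.ker (v.toCLM : τ →ₗ[ℂ] π))ᗮ) :
    ∃ C ∈ inducedIntertwiners φ π η, Q.toCLM = C ∘L ContinuousLinearMap.adjoint C ∧
      ContinuousLinearMap.adjoint C = v.fock φ ∘L B := by
  have hvB : ∀ x n, (v.fock φ ∘L B) x n = (poissonCoeff φ η (v.comp r) n).toCLM x := by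
    intro x n
    rw [poissonCoeff_comp]
    exact congrArg (v.power φ n).toCLM (hB x n)
  obtain ⟨h1, h2⟩ := poissonKernel_adjoint_mem φ η hQ
    ((comp_adj_comp_self hv hvr).trans hr) hvB
  exact ⟨_, h1, h2, ContinuousLinearMap.adjoint_adjoint _⟩

end FromPartialIsometry

end

end WCorr

theorem mainTheorem4
    {M : Type*} [CStarAlgebra M] [PartialOrder M] [StarOrderedRing M]
    {X : Type*} [NormedAddCommGroup X] [NormedSpace ℂ X] [CompleteSpace X]
    (p : M ≃ₗᵢ[ℂ] StrongDual ℂ X)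
    {E : Type*} [NormedAddCommGroup E] [NormedSpace ℂ E] [Module Mᵐᵒᵖ E] [HilbertModule M E]
    (φ : LeftAction M E) (_hE : IsWStarCorrespondence p φ)
    (σ π : HilbertRep M) [TopologicalSpace.SeparableSpace σ]
    (_hσ : σ.IsNormal p) (_hπ : π.IsInfiniteAmpliation p)
    (η : SigmaDual φ σ) (Q : Commutant σ) :
    (IsPureSuperharmonic (cpMap φ η) Q ↔
      ∃ C ∈ inducedIntertwiners φ π η, Q.toCLM = C ∘L ContinuousLinearMap.adjoint C) ∧
    (IsPureSuperharmonic (cpMap φ η) Q →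
      let r : Commutant σ := sqrtDefect (cpMap φ η) Q
      ∃ B : σ →L[ℂ] Fock φ σ,
        (∀ (x : σ) (n : ℕ), B x n = (r.power φ n).toCLM ((genPower φ η n).toCLM x)) ∧
        (∀ v : Intertwiner σ π, IsPartialIsometry v.toCLM →
          (LinearMap.range (r.toCLM : σ →ₗ[ℂ] σ)).topologicalClosure ≤
            (LinearMap.ker (v.toCLM : σ →ₗ[ℂ] π))ᗮ →
          ∃ C ∈ inducedIntertwiners φ π η, Q.toCLM = C ∘L ContinuousLinearMap.adjoint C ∧
            ContinuousLinearMap.adjoint C = v.fock φ ∘L B) ∧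
        (∀ C ∈ inducedIntertwiners φ π η, Q.toCLM = C ∘L ContinuousLinearMap.adjoint C →
          ∃ v : Intertwiner σ π, IsPartialIsometry v.toCLM ∧
            (LinearMap.range (r.toCLM : σ →ₗ[ℂ] σ)).topologicalClosure ≤
              (LinearMap.ker (v.toCLM : σ →ₗ[ℂ] π))ᗮ ∧
            ContinuousLinearMap.adjoint C = v.fock φ ∘L B)) := by
  have hex : ∀ hQ : IsPureSuperharmonic (cpMap φ η) Q, ∃ B : σ →L[ℂ] Fock φ σ, ∀ x n,
      B x n = (poissonCoeff φ η (sqrtDefect (cpMap φ η) Q) n).toCLM x := fun hQ =>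
    exists_poissonKernel φ η hQ (sqrtDefect_adj_comp_self hQ.toIsSuperharmonic)
  refine ⟨⟨fun hQ => ?_, ?_⟩, fun hQ => ?_⟩
  · obtain ⟨B, hB⟩ := hex hQ
    -- An isometry has full initial space, so it is admissible whatever the range of `r`.
    obtain ⟨v, hv⟩ := exists_isometric_intertwiner (_hπ.isAbsorbing p) (_hπ.hasNormalCoeff p)
      (_hπ.injective p) (_hσ.hasNormalCoeff p)
    have hker : LinearMap.ker (v.toCLM : σ →ₗ[ℂ] π) = ⊥ := by
      refine (Submodule.eq_bot_iff _).mpr fun x hx => ?_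
      have hx0 : v.toCLM x = 0 := hx
      rw [← norm_eq_zero, ← hv, hx0, norm_zero]
    obtain ⟨C, hC, hQC, -⟩ := exists_intertwiner_of_partialIsometry φ η hQ
      (sqrtDefect_adj_comp_self hQ.toIsSuperharmonic) hB (v := v) (fun x _ => hv x)
      (by rw [hker, Submodule.bot_orthogonal_eq_top]; exact le_top)
    exact ⟨C, hC, hQC⟩
  · rintro ⟨C, hC, hQC⟩
    obtain ⟨c, hc⟩ := exists_poissonCoeff_eq φ η hC
    exact (defect_of_poissonKernel φ η hc hQC).2
  · obtain ⟨B, hB⟩ := hex hQ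
    have hr := sqrtDefect_adj_comp_self hQ.toIsSuperharmonic
    refine ⟨B, hB, fun v hv hvr => ?_, fun C hC hQC => ?_⟩
    · exact exists_intertwiner_of_partialIsometry φ η hQ hr hB hv hvr
    · obtain ⟨c, hc⟩ := exists_poissonCoeff_eq φ η hC
      obtain ⟨hdef, -⟩ := defect_of_poissonKernel φ η hc hQC
      -- Both c* c and r* r equal Q - Φ(Q), so polar decomposition writes the degree-zero
      -- coefficient of C* as v r; the higher ones follow.
      obtain ⟨v, hv, hvr, rfl⟩ := exists_partialIsometry c (sqrtDefect (cpMap φ η) Q)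
        (norm_eq_of_adj_comp_eq (hdef.trans hr.symm))
      refine ⟨v, hv, hvr, ?_⟩
      ext x n
      refine (hc x n).trans ?_
      rw [poissonCoeff_comp]
      exact congrArg (v.power φ n).toCLM (hB x n).symm
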